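/- All vector spaces are over $\mathbb{C}$, and $\mathbb{Z}_+=\{0,1,2,\dots\}$. For $N\in\mathbb{Z}_+\cup\{\infty\}$ let $\mathbb{C}^N$ be the space with basis $e_1,e_2,\dots$ ($N$ vectors, countably many if $N=\infty$), and let $\mathfrak{gl}_N$ be the Lie algebra of $N\times N$ matrices with finitely many nonzero entries, acting on $\mathbb{C}^N$. Let $\mathrm{Rep}(\mathfrak{gl}_N)_{poly}$ be the full subcategory of $\mathfrak{gl}_N$-modules consisting of the direct summands of finite direct sums of tensor powers $(\mathbb{C}^N)^{\otimes d}$, $d\ge 0$. Let $\mathrm{Rep}(S_d)$ be the category of finite-dimensional representations of the symmetric group $S_d$, and let $\bigoplus_{d}\mathrm{Rep}(S_d)$ be the category whose objects are families $(X_d)_{d\in\mathbb{Z}_+}$, $X_d\in\mathrm{Rep}(S_d)$, with $X_d=0$ for all but finitely many $d$, and whose morphisms are families of morphisms. The group $S_d$ acts on $(\mathbb{C}^N)^{\otimes d}$ by $\sigma(v_1\otimes\cdots\otimes v_d)=v_{\sigma^{-1}(1)}\otimes\cdots\otimes v_{\sigma^{-1}(d)}$, and the Schur–Weyl functor is the contravariant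 functor $$SW_{N}:\bigoplus_{d}\mathrm{Rep}(S_d)\to \mathrm{Rep}(\mathfrak{gl}_N)_{poly},\qquad SW_{N}\big((X_d)_d\big)=\bigoplus_d \mathrm{Hom}_{S_d}\big(X_d,(\mathbb{C}^N)^{\otimes d}\big).$$ For $n\ge 0$ let $\mathfrak{gl}_n^{\perp}\subset\mathfrak{gl}_{n+1}$ consist of the matrices $(a_{ij})$ with $a_{ij}=0$ whenever $i\le n$ or $j\le n$, and let $\mathrm{Res}_{n,n+1}:\mathrm{Rep}(\mathfrak{gl}_{n+1})_{poly}\to\mathrm{Rep}(\mathfrak{gl}_n)_{poly}$ be the functor $M\mapsto M^{\mathfrak{gl}_n^\perp}$ of invariants. The inverse limit of these categories has as objects the sequences $(M_n)_{n\ge 0}$, $M_n\in\mathrm{Rep}(\mathfrak{gl}_n)_{poly}$, together with isomorphisms $\mathrm{Res}_{n,n+1}(M_{n+1})\cong M_n$, and as morphisms the sequences of morphisms compatible with these isomorphisms. The restricted inverse limit $\varprojlim_{n,\,restr}\mathrm{Rep}(\mathfrak{gl}_n)_{poly}$ is its full subcategory of objects for which the lengths of the $M_n$ are bounded. The inclusions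 $\mathbb{C}^n\subset\mathbb{C}^{n+1}$ induce natural isomorphisms $\mathrm{Res}_{n,n+1}\circ SW_{n+1}\cong SW_{n}$, so the functors $SW_{n}$, $n\ge 0$, define a contravariant functor $SW_{\lim}$ from $\bigoplus_d\mathrm{Rep}(S_d)$ to the inverse limit. **Proposition.** The categories $\bigoplus_{d}\mathrm{Rep}(S_d)$, $\mathrm{Rep}(\mathfrak{gl}_\infty)_{poly}$ and $\varprojlim_{n,\,restr}\mathrm{Rep}(\mathfrak{gl}_n)_{poly}$ are semisimple (abelian, with every object a finite direct sum of simple objects). The functor $SW_{\lim}$ takes values in the restricted inverse limit, and the contravariant $\mathbb{C}$-linear functors $$SW_\infty:\bigoplus_{d}\mathrm{Rep}(S_d)\to \mathrm{Rep}(\mathfrak{gl}_\infty)_{poly},\qquad SW_{\lim}:\bigoplus_{d}\mathrm{Rep}(S_d)\to \varprojlim_{n,\,restr}\mathrm{Rep}(\mathfrak{gl}_n)_{poly}$$ are anti-equivalences of categories. -/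

import Mathlib

open CategoryTheory CategoryTheory.Limits
open scoped TensorProduct DirectSum

noncomputable section

namespace SchurWeyl

attribute [local instance] LieRing.ofAssociativeRing

/-! ### The Lie algebra of finitary matrices and its tensor representations -/

/-- The Lie algebra `𝔤𝔩_N` of square matrices with rows and columns indexed by `ι` and finitely many
nonzero entries, realised as endomorphisms of the space `ι →₀ ℂ` with basis `ι`. For `ι = Fin n` the
finiteness condition is void, and for `ι = ℕ` this is `𝔤𝔩_∞`. -/
def gl (ι : Type) : LieSubalgebra ℂ (Module.End ℂ (ι →₀ ℂ)) where
  carrier := {A | {p : ι × ι | A (Finsupp.single p.2 1) p.1 ≠ 0}.Finite}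
  zero_mem' := by simp
  add_mem' {A B} hA hB := by
    refine (Set.Finite.union hA hB).subset fun p hp => ?_
    by_contra h
    simp only [Set.mem_union, Set.mem_ofPred_eq, not_or, not_not] at h
    exact hp (by simp [h.1, h.2])
  smul_mem' c A hA := by
    refine Set.Finite.subset hA fun p hp h => hp ?_
    simp [h]
  lie_mem' {A B} hA hB := by
    have key : ∀ A B : Module.End ℂ (ι →₀ ℂ),
        {p : ι × ι | A (Finsupp.single p.2 1) p.1 ≠ 0}.Finite →
        {p : ι × ι | B (Finsupp.single p.2 1) p.1 ≠ 0}.Finite →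
        {p : ι × ι | (A * B) (Finsupp.single p.2 1) p.1 ≠ 0}.Finite := by
      intro A B hA hB
      refine ((hA.image Prod.fst).prod (hB.image Prod.snd)).subset fun p hp => ?_
      have h1 : (A * B) (Finsupp.single p.2 1) p.1 =
          (B (Finsupp.single p.2 1)).sum fun k c => c * A (Finsupp.single k 1) p.1 := by
        conv_lhs => rw [Module.End.mul_apply, ← Finsupp.sum_single (B (Finsupp.single p.2 1))]
        rw [map_finsuppSum, Finsupp.sum_apply]
        refine Finsupp.sum_congr fun k _ => ?_
        rw [← mul_one (B (Finsupp.single p.2 1) k), ← smul_eq_mul, ← Finsupp.smul_single, map_smul]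
        simp
      have hp' : (A * B) (Finsupp.single p.2 1) p.1 ≠ 0 := hp
      rw [h1] at hp'
      obtain ⟨k, hk, hne⟩ := Finset.exists_ne_zero_of_sum_ne_zero hp'
      exact ⟨⟨(p.1, k), right_ne_zero_of_mul hne, rfl⟩, ⟨(k, p.2), left_ne_zero_of_mul hne, rfl⟩⟩
    refine ((key A B hA hB).union (key B A hB hA)).subset fun p hp => ?_
    by_contra h
    simp only [Set.mem_union, Set.mem_ofPred_eq, not_or, not_not] at h
    exact hp (by
      rw [LieRing.of_associative_ring_bracket, LinearMap.sub_apply, Finsupp.sub_apply, h.1, h.2, sub_zero])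

/-- The tensor power `(ℂ^N)^{⊗ d}`. -/
abbrev TPow (ι : Type) (d : ℕ) : Type := ⨂[ℂ] _ : Fin d, (ι →₀ ℂ)

section Tensor

variable {V W : Type} [AddCommGroup V] [Module ℂ V] [AddCommGroup W] [Module ℂ W] {d : ℕ}

/-- The operator `1 ⊗ ⋯ ⊗ A ⊗ ⋯ ⊗ 1` with `A` in position `k`. -/
def tensorAt (k : Fin d) (A : Module.End ℂ V) : Module.End ℂ (⨂[ℂ] _ : Fin d, V) :=
  PiTensorProduct.map (Function.update (fun _ => LinearMap.id) k A)

/-- The action of `A` on `V^{⊗ d}` by the Leibniz rule. -/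
def tensorDeriv (d : ℕ) (A : Module.End ℂ V) : Module.End ℂ (⨂[ℂ] _ : Fin d, V) :=
  ∑ k, tensorAt k A

lemma tensorAt_tprod (k : Fin d) (A : Module.End ℂ V) (v : Fin d → V) :
    tensorAt k A (PiTensorProduct.tprod ℂ v) =
      PiTensorProduct.tprod ℂ (Function.update v k (A (v k))) := by
  rw [tensorAt, PiTensorProduct.map_tprod]
  congr 1
  funext j
  by_cases h : j = k
  · subst h; simp
  · simp [h]

lemma tensorDeriv_tprod (A : Module.End ℂ V) (v : Fin d → V) :
    tensorDeriv d A (PiTensorProduct.tprod ℂ v) =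
      ∑ k, PiTensorProduct.tprod ℂ (Function.update v k (A (v k))) := by
  simp [tensorDeriv, tensorAt_tprod]

lemma tensorAt_mul (k : Fin d) (A B : Module.End ℂ V) :
    tensorAt k (A * B) = tensorAt k A * tensorAt k B := by
  refine PiTensorProduct.ext (MultilinearMap.ext fun v => ?_)
  simp [tensorAt_tprod]

lemma tensorAt_comm {k l : Fin d} (h : k ≠ l) (A B : Module.End ℂ V) :
    tensorAt k A * tensorAt l B = tensorAt l B * tensorAt k A := by
  refine PiTensorProduct.ext (MultilinearMap.ext fun v => ?_)
  simp [tensorAt_tprod, h, h.symm, Function.update_comm h]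

lemma tensorAt_add (k : Fin d) (A B : Module.End ℂ V) :
    tensorAt k (A + B) = tensorAt k A + tensorAt k B :=
  PiTensorProduct.map_update_add _ _ _ _

lemma tensorAt_smul (k : Fin d) (c : ℂ) (A : Module.End ℂ V) :
    tensorAt k (c • A) = c • tensorAt k A :=
  PiTensorProduct.map_update_smul _ _ _ _

lemma tensorDeriv_add (A B : Module.End ℂ V) :
    tensorDeriv d (A + B) = tensorDeriv d A + tensorDeriv d B := by
  simp [tensorDeriv, tensorAt_add, Finset.sum_add_distrib]

lemma tensorDeriv_smul (c : ℂ) (A : Module.End ℂ V) :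
    tensorDeriv d (c • A) = c • tensorDeriv d A := by
  simp [tensorDeriv, tensorAt_smul, Finset.smul_sum]

lemma tensorDeriv_lie (A B : Module.End ℂ V) :
    tensorDeriv d ⁅A, B⁆ = tensorDeriv d A * tensorDeriv d B - tensorDeriv d B * tensorDeriv d A := by
  have hsub : ∀ k : Fin d, tensorAt k ⁅A, B⁆ =
      tensorAt k A * tensorAt k B - tensorAt k B * tensorAt k A := by
    intro k
    have := tensorAt_add k ⁅A, B⁆ (B * A)
    rw [LieRing.of_associative_ring_bracket, sub_add_cancel, tensorAt_mul, tensorAt_mul] at this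
    rw [this, LieRing.of_associative_ring_bracket, add_sub_cancel_right]
  simp only [tensorDeriv, hsub, Finset.sum_mul_sum]
  conv_rhs => rw [Finset.sum_comm (f := fun i j => tensorAt i B * tensorAt j A)]
  rw [← Finset.sum_sub_distrib]
  refine Finset.sum_congr rfl fun k _ => ?_
  rw [← Finset.sum_sub_distrib, Finset.sum_eq_single k]
  · intro l _ hl
    rw [tensorAt_comm hl.symm, sub_self]
  · simp

/-- The tensor power of a linear map. -/
def tensorMap (d : ℕ) (g : V →ₗ[ℂ] W) : (⨂[ℂ] _ : Fin d, V) →ₗ[ℂ] ⨂[ℂ] _ : Fin d, W :=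
  PiTensorProduct.map fun _ => g

lemma tensorMap_tensorDeriv (g : V →ₗ[ℂ] W) (A : Module.End ℂ V) (B : Module.End ℂ W)
    (h : ∀ v, g (A v) = B (g v)) (t : ⨂[ℂ] _ : Fin d, V) :
    tensorMap d g (tensorDeriv d A t) = tensorDeriv d B (tensorMap d g t) := by
  suffices tensorMap d g ∘ₗ tensorDeriv d A = tensorDeriv d B ∘ₗ tensorMap d g from
    LinearMap.congr_fun this t
  refine PiTensorProduct.ext (MultilinearMap.ext fun v => ?_)
  simp only [LinearMap.compMultilinearMap_apply, LinearMap.comp_apply, tensorDeriv_tprod, tensorMap,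
    map_sum, PiTensorProduct.map_tprod]
  refine Finset.sum_congr rfl fun k _ => ?_
  congr 1
  funext j
  by_cases hj : j = k
  · subst hj; simp [h]
  · simp [hj]

end Tensor

variable {ι κ : Type} {d : ℕ}

/-- The Lie algebra action on `(ℂ^N)^{⊗ d}`. -/
instance : LieRingModule (gl ι) (TPow ι d) where
  bracket A t := tensorDeriv d A.1 t
  add_lie A B t := by
    change tensorDeriv d (A.1 + B.1) t = _
    rw [tensorDeriv_add]; rfl
  lie_add A s t := map_add _ _ _
  leibniz_lie A B t := by
    change tensorDeriv d A.1 (tensorDeriv d B.1 t) =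
      tensorDeriv d ⁅A.1, B.1⁆ t + tensorDeriv d B.1 (tensorDeriv d A.1 t)
    rw [tensorDeriv_lie]
    exact (sub_add_cancel (tensorDeriv d A.1 (tensorDeriv d B.1 t))
      (tensorDeriv d B.1 (tensorDeriv d A.1 t))).symm

lemma lie_tpow (A : gl ι) (t : TPow ι d) : ⁅A, t⁆ = tensorDeriv d A.1 t := rfl

instance : LieModule ℂ (gl ι) (TPow ι d) where
  smul_lie c A t := by
    change tensorDeriv d (c • A.1) t = _
    rw [tensorDeriv_smul]; rfl
  lie_smul c A t := map_smul _ _ _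

/-- The permutation of tensor factors
`v₁ ⊗ ⋯ ⊗ v_d ↦ v_{σ⁻¹ 1} ⊗ ⋯ ⊗ v_{σ⁻¹ d}`. -/
def permMap (ι : Type) {d : ℕ} (σ : Equiv.Perm (Fin d)) : TPow ι d →ₗ[ℂ] TPow ι d :=
  (PiTensorProduct.reindex ℂ (fun _ => ι →₀ ℂ) σ).toLinearMap

lemma permMap_tprod (σ : Equiv.Perm (Fin d)) (v : Fin d → ι →₀ ℂ) :
    permMap ι σ (PiTensorProduct.tprod ℂ v) = PiTensorProduct.tprod ℂ fun k => v (σ⁻¹ k) :=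
  PiTensorProduct.reindex_tprod _ _

/-- The action of `S_d` on the space `(ℂ^N)^{⊗ d}` by permuting the factors. -/
def permTPow (ι : Type) (d : ℕ) : Representation ℂ (Equiv.Perm (Fin d)) (TPow ι d) where
  toFun σ := permMap ι σ
  map_one' := by
    refine PiTensorProduct.ext (MultilinearMap.ext fun v => ?_)
    simp [permMap_tprod]
  map_mul' σ τ := by
    refine PiTensorProduct.ext (MultilinearMap.ext fun v => ?_)
    simp [permMap_tprod]

lemma permTPow_tprod (σ : Equiv.Perm (Fin d)) (v : Fin d → ι →₀ ℂ) :
    permTPow ι d σ (PiTensorProduct.tprod ℂ v) = PiTensorProduct.tprod ℂ fun k => v (σ⁻¹ k) :=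
  permMap_tprod σ v

lemma permTPow_tensorDeriv (σ : Equiv.Perm (Fin d)) (A : Module.End ℂ (ι →₀ ℂ)) (t : TPow ι d) :
    tensorDeriv d A (permTPow ι d σ t) = permTPow ι d σ (tensorDeriv d A t) := by
  suffices tensorDeriv d A ∘ₗ permTPow ι d σ = permTPow ι d σ ∘ₗ tensorDeriv d A from
    LinearMap.congr_fun this t
  refine PiTensorProduct.ext (MultilinearMap.ext fun v => ?_)
  simp only [LinearMap.compMultilinearMap_apply, LinearMap.comp_apply, permTPow_tprod,
    tensorDeriv_tprod, map_sum]
  refine Fintype.sum_equiv σ⁻¹ _ _ fun k => ?_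
  congr 1
  funext j
  by_cases hj : j = k
  · subst hj; simp
  · simp [hj]

lemma permTPow_tensorMap (σ : Equiv.Perm (Fin d)) (g : (ι →₀ ℂ) →ₗ[ℂ] (κ →₀ ℂ)) (t : TPow ι d) :
    tensorMap d g (permTPow ι d σ t) = permTPow κ d σ (tensorMap d g t) := by
  suffices tensorMap d g ∘ₗ permTPow ι d σ = permTPow κ d σ ∘ₗ tensorMap d g from
    LinearMap.congr_fun this t
  refine PiTensorProduct.ext (MultilinearMap.ext fun v => ?_)
  simp [permTPow_tprod, tensorMap]

/-! ### Representations and polynomial representations -/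

/-- Representations of a complex Lie algebra `L`. -/
structure LieRep (L : Type) [LieRing L] [LieAlgebra ℂ L] where
  carrier : Type
  [addCommGroup : AddCommGroup carrier]
  [module : Module ℂ carrier]
  [lieRingModule : LieRingModule L carrier]
  [lieModule : LieModule ℂ L carrier]

attribute [instance] LieRep.addCommGroup LieRep.module LieRep.lieRingModule LieRep.lieModule

section LieRepCat

variable (L : Type) [LieRing L] [LieAlgebra ℂ L]

/-- Morphisms are the `L`-equivariant linear maps. -/
instance : Category (LieRep L) where
  Hom M N := M.carrier →ₗ⁅ℂ, L⁆ N.carrier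
  id M := LieModuleHom.id
  comp f g := LieModuleHom.comp g f

instance : Preadditive (LieRep L) where
  homGroup M N := inferInstanceAs (AddCommGroup (M.carrier →ₗ⁅ℂ, L⁆ N.carrier))
  add_comp M N K f f' g := LieModuleHom.ext fun m =>
    map_add (show N.carrier →ₗ⁅ℂ, L⁆ K.carrier from g) ((show M.carrier →ₗ⁅ℂ, L⁆ N.carrier from f) m)
      ((show M.carrier →ₗ⁅ℂ, L⁆ N.carrier from f') m)
  comp_add _ _ _ _ _ _ := rfl

instance : Linear ℂ (LieRep L) where
  homModule M N := inferInstanceAs (Module ℂ (M.carrier →ₗ⁅ℂ, L⁆ N.carrier))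
  smul_comp M N K c f g := LieModuleHom.ext fun m =>
    map_smul (show N.carrier →ₗ⁅ℂ, L⁆ K.carrier from g) c
      ((show M.carrier →ₗ⁅ℂ, L⁆ N.carrier from f) m)
  comp_smul _ _ _ _ _ _ := rfl

end LieRepCat

/-- The representation `(ℂ^N)^{⊗ d}` of `𝔤𝔩_N`. -/
def tensorRep (ι : Type) (d : ℕ) : LieRep (gl ι) := ⟨TPow ι d⟩

/-- A representation of `𝔤𝔩_N` is polynomial if it is a direct summand of a finite direct sum of tensor
powers of the tautological representation. -/
def IsPolynomial (ι : Type) : ObjectProperty (LieRep (gl ι)) := fun M =>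
  ∃ (J : Type) (_ : Finite J) (d : J → ℕ)
    (i : M.carrier →ₗ⁅ℂ, gl ι⁆ ⨁ j, (tensorRep ι (d j)).carrier)
    (p : (⨁ j, (tensorRep ι (d j)).carrier) →ₗ⁅ℂ, gl ι⁆ M.carrier), ∀ m, p (i m) = m

/-- The category `Rep(𝔤𝔩_N)_poly`. -/
abbrev RepPoly (ι : Type) : Type 1 := (IsPolynomial ι).FullSubcategory

lemma lieModuleHom_sum_apply {L M N J : Type} [LieRing L] [LieAlgebra ℂ L] [AddCommGroup M] [Module ℂ M]
    [LieRingModule L M] [LieModule ℂ L M] [AddCommGroup N] [Module ℂ N] [LieRingModule L N]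
    [LieModule ℂ L N] (s : Finset J) (f : J → M →ₗ⁅ℂ, L⁆ N) (m : M) :
    (∑ j ∈ s, f j) m = ∑ j ∈ s, f j m := by
  classical
  induction s using Finset.induction_on with
  | empty => simp
  | insert j s hj ih => rw [Finset.sum_insert hj, Finset.sum_insert hj, LieModuleHom.add_apply, ih]

lemma isPolynomial_of_sum_aux (M : LieRep (gl ι)) {J : Type} [Fintype J] (d : J → ℕ)
    (i : ∀ j, M.carrier →ₗ⁅ℂ, gl ι⁆ (tensorRep ι (d j)).carrier)
    (p : ∀ j, (tensorRep ι (d j)).carrier →ₗ⁅ℂ, gl ι⁆ M.carrier)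
    (h : ∀ m, ∑ j, p j (i j m) = m) : IsPolynomial ι M := by
  classical
  refine ⟨J, inferInstance, d,
    ∑ j, (DirectSum.lieModuleOf ℂ J (gl ι) (fun j => (tensorRep ι (d j)).carrier) j).comp (i j),
    ∑ j, (p j).comp
      (DirectSum.lieModuleComponent ℂ J (gl ι) (fun j => (tensorRep ι (d j)).carrier) j), fun m => ?_⟩
  rw [lieModuleHom_sum_apply]
  refine (Finset.sum_congr rfl fun j _ => ?_).trans (h m)
  refine congrArg (p j) ?_
  rw [lieModuleHom_sum_apply, map_sum, Finset.sum_eq_single j]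
  · exact DirectSum.component.lof_self ℂ (M := fun j => (tensorRep ι (d j)).carrier) j (i j m)
  · intro k _ hk
    exact (DirectSum.component.of (R := ℂ) (M := fun j => (tensorRep ι (d j)).carrier) j k
      (i k m)).trans (dif_neg hk)
  · simp

lemma isPolynomial_of_sum (M : LieRep (gl ι)) {J : Type} [Fintype J] (d : J → ℕ)
    (i : ∀ j, M.carrier →ₗ⁅ℂ, gl ι⁆ TPow ι (d j)) (p : ∀ j, TPow ι (d j) →ₗ⁅ℂ, gl ι⁆ M.carrier)
    (h : ∀ m, ∑ j, p j (i j m) = m) : IsPolynomial ι M :=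
  isPolynomial_of_sum_aux M d i p h

lemma IsPolynomial.exists_sum_aux {M : LieRep (gl ι)} (hM : IsPolynomial ι M) :
    ∃ (J : Type) (_ : Fintype J) (d : J → ℕ)
      (i : ∀ j, M.carrier →ₗ⁅ℂ, gl ι⁆ (tensorRep ι (d j)).carrier)
      (p : ∀ j, (tensorRep ι (d j)).carrier →ₗ⁅ℂ, gl ι⁆ M.carrier), ∀ m, ∑ j, p j (i j m) = m := by
  classical
  obtain ⟨J, hJ, d, i, p, h⟩ := hM
  have := Fintype.ofFinite J
  refine ⟨J, this, d, fun j => (DirectSum.lieModuleComponent ℂ J (gl ι)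
      (fun j => (tensorRep ι (d j)).carrier) j).comp i,
    fun j => p.comp (DirectSum.lieModuleOf ℂ J (gl ι) (fun j => (tensorRep ι (d j)).carrier) j),
    fun m => ?_⟩
  refine Eq.trans ?_ (h m)
  refine Eq.trans (map_sum p (fun j => DirectSum.lieModuleOf ℂ J (gl ι)
    (fun j => (tensorRep ι (d j)).carrier) j (i m j)) Finset.univ).symm ?_
  exact congrArg p (DirectSum.sum_univ_of (i m))

lemma IsPolynomial.exists_sum {M : LieRep (gl ι)} (hM : IsPolynomial ι M) :
    ∃ (J : Type) (_ : Fintype J) (d : J → ℕ) (i : ∀ j, M.carrier →ₗ⁅ℂ, gl ι⁆ TPow ι (d j))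
      (p : ∀ j, TPow ι (d j) →ₗ⁅ℂ, gl ι⁆ M.carrier), ∀ m, ∑ j, p j (i j m) = m :=
  hM.exists_sum_aux

/-! ### Restriction functors -/

/-- The inclusion `ℂ^κ → ℂ^ι` along `e`. -/
def incl (e : κ ↪ ι) : (κ →₀ ℂ) →ₗ[ℂ] (ι →₀ ℂ) := Finsupp.lmapDomain ℂ ℂ e

/-- The coordinate projection `ℂ^ι → ℂ^κ` along `e`. -/
def proj (e : κ ↪ ι) : (ι →₀ ℂ) →ₗ[ℂ] (κ →₀ ℂ) := Finsupp.lcomapDomain e e.injective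

lemma proj_apply (e : κ ↪ ι) (v : ι →₀ ℂ) (k : κ) : proj e v k = v (e k) := rfl

lemma incl_apply (e : κ ↪ ι) (v : κ →₀ ℂ) (k : κ) : incl e v (e k) = v k :=
  Finsupp.mapDomain_apply e.injective v k

lemma incl_apply_of_notMem (e : κ ↪ ι) (v : κ →₀ ℂ) {i : ι} (hi : i ∉ Set.range e) :
    incl e v i = 0 :=
  Finsupp.mapDomain_of_notMem_range v i hi

lemma incl_single (e : κ ↪ ι) (k : κ) : incl e (Finsupp.single k 1) = Finsupp.single (e k) 1 :=
  Finsupp.mapDomain_single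

lemma proj_incl (e : κ ↪ ι) (v : κ →₀ ℂ) : proj e (incl e v) = v := by
  ext k
  rw [proj_apply, incl_apply]

lemma proj_single (e : κ ↪ ι) (k : κ) : proj e (Finsupp.single (e k) 1) = Finsupp.single k 1 := by
  rw [← incl_single, proj_incl]

lemma proj_single_of_notMem (e : κ ↪ ι) {i : ι} (hi : i ∉ Set.range e) :
    proj e (Finsupp.single i 1) = 0 := by
  ext k
  rw [proj_apply, Finsupp.single_eq_of_ne fun h => hi ⟨k, h⟩]
  rfl

/-- The inclusion `𝔤𝔩_κ ⊆ 𝔤𝔩_ι` by zero rows and columns outside the range of `e`. -/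
def glIncl (e : κ ↪ ι) (A : gl κ) : gl ι :=
  ⟨incl e ∘ₗ A.1 ∘ₗ proj e, by
    refine (Set.Finite.image (Prod.map e e) A.2).subset fun p hp => ?_
    have hp' : incl e (A.1 (proj e (Finsupp.single p.2 1))) p.1 ≠ 0 := hp
    by_cases h2 : p.2 ∈ Set.range e
    · by_cases h1 : p.1 ∈ Set.range e
      · obtain ⟨k, hk⟩ := h1
        obtain ⟨l, hl⟩ := h2
        rw [← hk, ← hl, incl_apply, proj_single] at hp'
        exact ⟨(k, l), hp', Prod.ext hk hl⟩
      · exact absurd (incl_apply_of_notMem e _ h1) hp'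
    · rw [proj_single_of_notMem e h2, map_zero, map_zero] at hp'
      exact absurd rfl hp'⟩

lemma glIncl_val (e : κ ↪ ι) (A : gl κ) (v : ι →₀ ℂ) :
    (glIncl e A).1 v = incl e (A.1 (proj e v)) := rfl

lemma glIncl_add (e : κ ↪ ι) (A B : gl κ) : glIncl e (A + B) = glIncl e A + glIncl e B := by
  refine Subtype.ext (LinearMap.ext fun v => ?_)
  exact map_add (incl e) (A.1 (proj e v)) (B.1 (proj e v))

lemma glIncl_smul (e : κ ↪ ι) (c : ℂ) (A : gl κ) : glIncl e (c • A) = c • glIncl e A := by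
  refine Subtype.ext (LinearMap.ext fun v => ?_)
  exact map_smul (incl e) c (A.1 (proj e v))

lemma glIncl_lie (e : κ ↪ ι) (A B : gl κ) : glIncl e ⁅A, B⁆ = ⁅glIncl e A, glIncl e B⁆ := by
  refine Subtype.ext (LinearMap.ext fun v => ?_)
  change incl e (A.1 (B.1 (proj e v)) - B.1 (A.1 (proj e v))) =
    incl e (A.1 (proj e (incl e (B.1 (proj e v))))) - incl e (B.1 (proj e (incl e (A.1 (proj e v)))))
  rw [proj_incl, proj_incl, map_sub]

/-- The set `𝔤𝔩_κ^⊥ ⊆ 𝔤𝔩_ι` of matrices `(a_{ij})` such that `a_{ij} = 0` whenever `i` or `j` lies in the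
range of `e`. -/
def glPerp (e : κ ↪ ι) : Set (gl ι) :=
  {A | ∀ i j, i ∈ Set.range e ∨ j ∈ Set.range e → A.1 (Finsupp.single j 1) i = 0}

lemma glPerp_incl (e : κ ↪ ι) {A : gl ι} (hA : A ∈ glPerp e) (v : κ →₀ ℂ) : A.1 (incl e v) = 0 := by
  induction v using Finsupp.induction_linear with
  | zero => simp
  | add v w hv hw => rw [map_add, map_add, hv, hw, add_zero]
  | single k c =>
    rw [← mul_one c, ← smul_eq_mul, ← Finsupp.smul_single, map_smul, map_smul, incl_single]
    have : A.1 (Finsupp.single (e k) 1) = 0 := by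
      ext i
      exact hA i (e k) (Or.inr ⟨k, rfl⟩)
    rw [this, smul_zero]

lemma proj_glPerp (e : κ ↪ ι) {A : gl ι} (hA : A ∈ glPerp e) (v : ι →₀ ℂ) : proj e (A.1 v) = 0 := by
  induction v using Finsupp.induction_linear with
  | zero => simp
  | add v w hv hw => rw [map_add, map_add, hv, hw, add_zero]
  | single i c =>
    rw [← mul_one c, ← smul_eq_mul, ← Finsupp.smul_single, map_smul, map_smul]
    have : proj e (A.1 (Finsupp.single i 1)) = 0 := by
      ext k
      exact hA (e k) i (Or.inl ⟨k, rfl⟩)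
    rw [this, smul_zero]

lemma glPerp_lie (e : κ ↪ ι) (A : gl κ) {B : gl ι} (hB : B ∈ glPerp e) : ⁅B, glIncl e A⁆ = 0 := by
  refine Subtype.ext (LinearMap.ext fun v => ?_)
  change B.1 (incl e (A.1 (proj e v))) - incl e (A.1 (proj e (B.1 v))) = 0
  rw [glPerp_incl e hB, proj_glPerp e hB, map_zero, map_zero, sub_zero]

/-- The invariants `M^{𝔤𝔩_κ^⊥}`. -/
def invariants (e : κ ↪ ι) (M : Type) [AddCommGroup M] [Module ℂ M] [LieRingModule (gl ι) M]
    [LieModule ℂ (gl ι) M] : Submodule ℂ M where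
  carrier := {m | ∀ B ∈ glPerp e, ⁅B, m⁆ = 0}
  zero_mem' B _ := lie_zero B
  add_mem' {m m'} hm hm' B hB := by rw [lie_add, hm B hB, hm' B hB, add_zero]
  smul_mem' c m hm B hB := by rw [lie_smul, hm B hB, smul_zero]

section Invariants

variable (e : κ ↪ ι) {M N : Type} [AddCommGroup M] [Module ℂ M] [LieRingModule (gl ι) M]
  [LieModule ℂ (gl ι) M] [AddCommGroup N] [Module ℂ N] [LieRingModule (gl ι) N]
  [LieModule ℂ (gl ι) N]

/-- `𝔤𝔩_κ` acts on the invariants through the inclusion `𝔤𝔩_κ ⊆ 𝔤𝔩_ι`. -/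
instance : LieRingModule (gl κ) (invariants e M) where
  bracket A m := ⟨⁅glIncl e A, m.1⁆, fun B hB => by
    rw [leibniz_lie, glPerp_lie e A hB, zero_lie, m.2 B hB, lie_zero, add_zero]⟩
  add_lie A B m := Subtype.ext <| by
    change ⁅glIncl e (A + B), m.1⁆ = ⁅glIncl e A, m.1⁆ + ⁅glIncl e B, m.1⁆
    rw [glIncl_add, add_lie]
  lie_add A m m' := Subtype.ext <| lie_add (glIncl e A) m.1 m'.1
  leibniz_lie A B m := Subtype.ext <| by
    change ⁅glIncl e A, ⁅glIncl e B, m.1⁆⁆ = ⁅glIncl e ⁅A, B⁆, m.1⁆ + ⁅glIncl e B, ⁅glIncl e A, m.1⁆⁆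
    rw [glIncl_lie, leibniz_lie]

lemma invariants_lie (A : gl κ) (m : invariants e M) : (⁅A, m⁆ : invariants e M).1 = ⁅glIncl e A, m.1⁆ :=
  rfl

instance : LieModule ℂ (gl κ) (invariants e M) where
  smul_lie c A m := Subtype.ext <| by
    change ⁅glIncl e (c • A), m.1⁆ = c • ⁅glIncl e A, m.1⁆
    rw [glIncl_smul, smul_lie]
  lie_smul c A m := Subtype.ext <| lie_smul c (glIncl e A) m.1

/-- The map induced on invariants. -/
def invariantsMap (f : M →ₗ⁅ℂ, gl ι⁆ N) : invariants e M →ₗ⁅ℂ, gl κ⁆ invariants e N where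
  toFun m := ⟨f m.1, fun B hB => by rw [← LieModuleHom.map_lie, m.2 B hB, map_zero]⟩
  map_add' m m' := Subtype.ext (map_add f m.1 m'.1)
  map_smul' c m := Subtype.ext (map_smul f c m.1)
  map_lie' {A m} := Subtype.ext (LieModuleHom.map_lie f (glIncl e A) m.1)

end Invariants

section TensorInvariants

variable (e : κ ↪ ι)

/-- The projection `(ℂ^ι)^{⊗ d} → (ℂ^κ)^{⊗ d}`. -/
def tproj (d : ℕ) : TPow ι d →ₗ[ℂ] TPow κ d := tensorMap d (proj e)

/-- The inclusion `(ℂ^κ)^{⊗ d} → (ℂ^ι)^{⊗ d}`. -/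
def tincl (d : ℕ) : TPow κ d →ₗ[ℂ] TPow ι d := tensorMap d (incl e)

lemma tproj_lie (A : gl κ) (t : TPow ι d) : tproj e d ⁅glIncl e A, t⁆ = ⁅A, tproj e d t⁆ :=
  tensorMap_tensorDeriv _ _ _ (fun v => by rw [glIncl_val, proj_incl]) t

lemma tincl_lie (A : gl κ) (t : TPow κ d) : tincl e d ⁅A, t⁆ = ⁅glIncl e A, tincl e d t⁆ :=
  tensorMap_tensorDeriv _ _ _ (fun v => by rw [glIncl_val, proj_incl]) t

lemma tproj_tincl (t : TPow κ d) : tproj e d (tincl e d t) = t := by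
  suffices tproj e d ∘ₗ tincl e d = LinearMap.id from LinearMap.congr_fun this t
  refine PiTensorProduct.ext (MultilinearMap.ext fun v => ?_)
  simp [tproj, tincl, tensorMap, proj_incl]

lemma glPerp_tincl {B : gl ι} (hB : B ∈ glPerp e) (t : TPow κ d) : ⁅B, tincl e d t⁆ = 0 := by
  rw [lie_tpow, tincl, ← tensorMap_tensorDeriv (incl e) 0 B.1
    (fun v => by rw [glPerp_incl e hB, LinearMap.zero_apply, map_zero])]
  have : tensorDeriv d (0 : Module.End ℂ (κ →₀ ℂ)) = 0 := by
    have h := tensorDeriv_smul (d := d) 0 (0 : Module.End ℂ (κ →₀ ℂ))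
    rwa [zero_smul, zero_smul] at h
  rw [this, LinearMap.zero_apply, map_zero]

/-- The diagonal matrix unit `E_{aa}`. -/
def diagUnit (a : ι) : gl ι :=
  ⟨Finsupp.lsingle a ∘ₗ Finsupp.lapply a, by
    refine (Set.finite_singleton (a, a)).subset fun p hp => ?_
    have hp' : Finsupp.single a ((Finsupp.single p.2 (1 : ℂ)) a) p.1 ≠ 0 := hp
    by_contra h
    apply hp'
    by_cases h1 : a = p.1
    · by_cases h2 : p.2 = a
      · exact absurd (Prod.ext h1.symm h2) h
      · rw [Finsupp.single_eq_of_ne (Ne.symm h2), Finsupp.single_zero, Finsupp.zero_apply]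
    · rw [Finsupp.single_eq_of_ne (Ne.symm h1)]⟩

lemma diagUnit_single (a i : ι) [Decidable (i = a)] :
    (diagUnit a).1 (Finsupp.single i 1) = if i = a then Finsupp.single i 1 else 0 := by
  change Finsupp.single a ((Finsupp.single i (1 : ℂ)) a) = _
  split_ifs with h
  · subst h; simp
  · rw [Finsupp.single_eq_of_ne (Ne.symm h), Finsupp.single_zero]

lemma diagUnit_mem {a : ι} (ha : a ∉ Set.range e) : diagUnit a ∈ glPerp e := by
  classical
  intro i j hij
  rw [diagUnit_single]
  split_ifs with h
  · subst h
    rcases hij with hi | hj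
    · exact Finsupp.single_eq_of_ne fun h => ha (h ▸ hi)
    · exact absurd hj ha
  · rfl

/-- A tensor invariant under `𝔤𝔩_κ^⊥` lies in the image of `(ℂ^κ)^{⊗ d}`. -/
lemma tincl_tproj (t : TPow ι d) (ht : ∀ B ∈ glPerp e, ⁅B, t⁆ = 0) : tincl e d (tproj e d t) = t := by
  classical
  let b := Basis.piTensorProduct fun _ : Fin d => (Finsupp.basisSingleOne : Module.Basis ι ℂ (ι →₀ ℂ))
  have hb : ∀ w, b w = PiTensorProduct.tprod ℂ fun k => Finsupp.single (w k) 1 := fun w => by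
    rw [Basis.piTensorProduct_apply]; simp
  have hdiag : ∀ (a : ι) (w : Fin d → ι) (s : TPow ι d), b.repr ⁅diagUnit a, s⁆ w =
      ((Finset.univ.filter fun k => w k = a).card : ℂ) * b.repr s w := by
    intro a w s
    suffices b.coord w ∘ₗ tensorDeriv d (diagUnit a).1 =
        ((Finset.univ.filter fun k => w k = a).card : ℂ) • b.coord w from LinearMap.congr_fun this s
    refine b.ext fun u => ?_
    have h1 : tensorDeriv d (diagUnit a).1 (b u) =
        ((Finset.univ.filter fun k => u k = a).card : ℂ) • b u := by
      rw [hb, tensorDeriv_tprod, Finset.card_filter, Nat.cast_sum, Finset.sum_smul]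
      refine Finset.sum_congr rfl fun k _ => ?_
      rw [diagUnit_single]
      split_ifs with h
      · rw [Function.update_eq_self (f := fun k => Finsupp.single (u k) (1 : ℂ)) k]; simp
      · rw [MultilinearMap.map_update_zero]; simp
    rw [LinearMap.comp_apply, h1, map_smul, LinearMap.smul_apply, b.coord_apply, b.repr_self,
      Finsupp.single_apply]
    split_ifs with h
    · rw [h]
    · simp
  have hpi : ∀ (w : Fin d → ι) (s : TPow ι d), b.repr (tincl e d (tproj e d s)) w =
      if ∀ k, w k ∈ Set.range e then b.repr s w else 0 := by
    intro w s
    suffices b.coord w ∘ₗ tincl e d ∘ₗ tproj e d =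
        (if ∀ k, w k ∈ Set.range e then (1 : ℂ) else 0) • b.coord w by
      have h := LinearMap.congr_fun this s
      rw [LinearMap.smul_apply] at h
      refine h.trans ?_
      split_ifs <;> simp
    refine b.ext fun u => ?_
    have h1 : tincl e d (tproj e d (b u)) = (if ∀ k, u k ∈ Set.range e then (1 : ℂ) else 0) • b u := by
      rw [hb, tincl, tproj, tensorMap, tensorMap, PiTensorProduct.map_tprod, PiTensorProduct.map_tprod]
      split_ifs with h
      · rw [one_smul]
        congr 1
        funext k
        obtain ⟨l, hl⟩ := h k
        rw [← hl, proj_single, incl_single]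
      · push Not at h
        obtain ⟨k, hk⟩ := h
        rw [zero_smul]
        exact MultilinearMap.map_coord_zero _ k (by
          rw [proj_single_of_notMem e hk, map_zero])
    rw [LinearMap.comp_apply, LinearMap.comp_apply, h1, map_smul, LinearMap.smul_apply, b.coord_apply,
      b.repr_self, Finsupp.single_apply]
    split_ifs <;> simp_all
  refine b.ext_elem fun w => ?_
  rw [hpi]
  split_ifs with h
  · rfl
  · push Not at h
    obtain ⟨k, hk⟩ := h
    have h0 := hdiag (w k) w t
    rw [ht _ (diagUnit_mem e hk), map_zero, Finsupp.zero_apply] at h0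
    rcases mul_eq_zero.mp h0.symm with h | h
    · rw [Nat.cast_eq_zero, Finset.card_eq_zero, Finset.filter_eq_empty_iff] at h
      exact absurd rfl (h (Finset.mem_univ k))
    · exact h.symm

end TensorInvariants

/-- The functor `M ↦ M^{𝔤𝔩_κ^⊥}` on all representations. -/
def resLieRep (e : κ ↪ ι) : LieRep (gl ι) ⥤ LieRep (gl κ) where
  obj M := ⟨invariants e M.carrier⟩
  map f := invariantsMap e f

lemma isPolynomial_res (e : κ ↪ ι) (M : LieRep (gl ι)) (hM : IsPolynomial ι M) :
    IsPolynomial κ ((resLieRep e).obj M) := by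
  obtain ⟨J, _, d, i, p, h⟩ := hM.exists_sum
  have hinv : ∀ (m : invariants e M.carrier) (j : J), ∀ B ∈ glPerp e, ⁅B, i j m.1⁆ = 0 := by
    intro m j B hB
    rw [← LieModuleHom.map_lie, m.2 B hB, map_zero]
  let i' : ∀ j, invariants e M.carrier →ₗ⁅ℂ, gl κ⁆ TPow κ (d j) := fun j =>
    { toFun := fun m => tproj e (d j) (i j m.1)
      map_add' := fun m m' => by rw [Submodule.coe_add, map_add, map_add]
      map_smul' := fun c m => by rw [Submodule.coe_smul, map_smul, map_smul]; rfl
      map_lie' := fun {A m} => by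
        change tproj e (d j) (i j ⁅glIncl e A, m.1⁆) = ⁅A, tproj e (d j) (i j m.1)⁆
        rw [LieModuleHom.map_lie, tproj_lie] }
  let p' : ∀ j, TPow κ (d j) →ₗ⁅ℂ, gl κ⁆ invariants e M.carrier := fun j =>
    { toFun := fun t => ⟨p j (tincl e (d j) t), fun B hB => by
        rw [← LieModuleHom.map_lie, glPerp_tincl e hB, map_zero]⟩
      map_add' := fun t t' => Subtype.ext (by simp)
      map_smul' := fun c t => Subtype.ext (by simp)
      map_lie' := fun {A t} => Subtype.ext (by
        change p j (tincl e (d j) ⁅A, t⁆) = ⁅glIncl e A, p j (tincl e (d j) t)⁆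
        rw [tincl_lie, LieModuleHom.map_lie]) }
  refine isPolynomial_of_sum _ d i' p' fun m => Subtype.ext ?_
  refine (map_sum (invariants e M.carrier).subtype (fun j => p' j (i' j m)) Finset.univ).trans ?_
  refine (Finset.sum_congr rfl fun j _ => ?_).trans (h m.1)
  change p j (tincl e (d j) (tproj e (d j) (i j m.1))) = _
  rw [tincl_tproj e _ (hinv m j)]

/-- The functor `(·)^{𝔤𝔩_κ^⊥} : Rep(𝔤𝔩_ι)_poly ⥤ Rep(𝔤𝔩_κ)_poly`. -/
def resPoly (e : κ ↪ ι) : RepPoly ι ⥤ RepPoly κ :=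
  (IsPolynomial κ).lift ((IsPolynomial ι).ι ⋙ resLieRep e) fun M => isPolynomial_res e M.obj M.property

/-! ### Schur–Weyl functors -/

/-- The category `Rep(S_d)` of finite-dimensional complex representations of `S_d`. -/
abbrev RepSym (d : ℕ) : Type 1 := FDRep ℂ (Equiv.Perm (Fin d))

/-- The families `(X_d)_d` with `X_d = 0` for all but finitely many `d`. -/
def FinitelySupported : ObjectProperty (∀ d, RepSym d) := fun X => {d | ¬ IsZero (X d)}.Finite

/-- The category `⨁_d Rep(S_d)`: finitely supported families of representations, and families of
morphisms between them. -/
abbrev SumRepSym : Type 1 := FinitelySupported.FullSubcategory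

/-- The underlying intertwining map of a morphism of representations. -/
def toIntertwining {X Y : RepSym d} (f : X ⟶ Y) : Representation.IntertwiningMap X.ρ Y.ρ where
  toLinearMap := f.hom.hom.hom
  isIntertwining' σ := by
    have h := congrArg (fun g => g.hom.hom) (f.comm σ)
    exact h

/-- The action of `S_d` on the representation `(ℂ^N)^{⊗ d}` by permuting the factors. -/
def permRep (ι : Type) (d : ℕ) :
    Representation ℂ (Equiv.Perm (Fin d)) (tensorRep ι d).carrier := permTPow ι d

lemma permRep_lie (σ : Equiv.Perm (Fin d)) (A : gl ι) (t : (tensorRep ι d).carrier) :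
    ⁅A, permRep ι d σ t⁆ = permRep ι d σ ⁅A, t⁆ :=
  permTPow_tensorDeriv σ A.1 t

/-- The space `Hom_{S_d}(X, (ℂ^N)^{⊗ d})`. -/
abbrev SWSpace (ι : Type) (X : RepSym d) : Type := Representation.IntertwiningMap X.ρ (permRep ι d)

/-- `𝔤𝔩_N` acts on `Hom_{S_d}(X, (ℂ^N)^{⊗ d})` through its action on `(ℂ^N)^{⊗ d}`. -/
instance (X : RepSym d) : LieRingModule (gl ι) (SWSpace ι X) where
  bracket A f := ⟨LieModule.toEnd ℂ (gl ι) (tensorRep ι d).carrier A ∘ₗ f.toLinearMap,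
    fun σ => LinearMap.ext fun x => by
      change ⁅A, f (X.ρ σ x)⁆ = permRep ι d σ ⁅A, f x⁆
      rw [f.isIntertwining, permRep_lie]⟩
  add_lie A B f := Representation.IntertwiningMap.ext <| LinearMap.ext fun x => add_lie A B (f x)
  lie_add A f g := Representation.IntertwiningMap.ext <| LinearMap.ext fun x => lie_add A (f x) (g x)
  leibniz_lie A B f :=
    Representation.IntertwiningMap.ext <| LinearMap.ext fun x => leibniz_lie A B (f x)

lemma lie_swSpace_apply (X : RepSym d) (A : gl ι) (f : SWSpace ι X) (x : X) : ⁅A, f⁆ x = ⁅A, f x⁆ := rfl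

instance (X : RepSym d) : LieModule ℂ (gl ι) (SWSpace ι X) where
  smul_lie c A f := Representation.IntertwiningMap.ext <| LinearMap.ext fun x => smul_lie c A (f x)
  lie_smul c A f := Representation.IntertwiningMap.ext <| LinearMap.ext fun x => lie_smul c A (f x)

/-- The contravariant functor `Hom_{S_d}(·, (ℂ^N)^{⊗ d})` from `Rep(S_d)` to representations of
`𝔤𝔩_N`. -/
def swDegree (ι : Type) (d : ℕ) : (RepSym d)ᵒᵖ ⥤ LieRep (gl ι) where
  obj X := ⟨SWSpace ι X.unop⟩
  map {X Y} φ :=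
    { toFun := fun f => f.comp (toIntertwining φ.unop)
      map_add' := fun f g => rfl
      map_smul' := fun c f => rfl
      map_lie' := rfl }

/-- The direct sum of a sequence of representations. -/
def sumLieRep (L : Type) [LieRing L] [LieAlgebra ℂ L] : (∀ _ : ℕ, LieRep L) ⥤ LieRep L where
  obj M := ⟨⨁ d, (M d).carrier⟩
  map {M N} f :=
    { DirectSum.lmap (fun d => (show (M d).carrier →ₗ⁅ℂ, L⁆ (N d).carrier from f d).toLinearMap) with
      map_lie' := fun {A m} => by
        ext d
        exact LieModuleHom.map_lie (show (M d).carrier →ₗ⁅ℂ, L⁆ (N d).carrier from f d) A (m d) }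
  map_id M := LieModuleHom.ext fun m => DFinsupp.ext fun d => rfl
  map_comp f g := LieModuleHom.ext fun m => DFinsupp.ext fun d => rfl

/-- The contravariant functor `(X_d)_d ↦ ⨁_d Hom_{S_d}(X_d, (ℂ^N)^{⊗ d})`. -/
def swLieRep (ι : Type) : SumRepSymᵒᵖ ⥤ LieRep (gl ι) where
  obj X := (sumLieRep (gl ι)).obj fun d => (swDegree ι d).obj (Opposite.op (X.unop.obj d))
  map {X Y} f := (sumLieRep (gl ι)).map (X := fun d => (swDegree ι d).obj (Opposite.op (X.unop.obj d)))
    (Y := fun d => (swDegree ι d).obj (Opposite.op (Y.unop.obj d)))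
    fun d => (swDegree ι d).map (Quiver.Hom.op (f.unop.hom d))
  map_id X := by
    refine LieModuleHom.ext fun m => DFinsupp.ext fun d => ?_
    rfl
  map_comp f g := by
    refine LieModuleHom.ext fun m => DFinsupp.ext fun d => ?_
    rfl

section SWPolynomial

variable (X : RepSym d)

/-- Averaging a linear map over `S_d`. -/
def average (g : X →ₗ[ℂ] (tensorRep ι d).carrier) : SWSpace ι X where
  toLinearMap := (Fintype.card (Equiv.Perm (Fin d)) : ℂ)⁻¹ •
    ∑ σ : Equiv.Perm (Fin d), permRep ι d σ ∘ₗ g ∘ₗ X.ρ σ⁻¹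
  isIntertwining' τ := by
    rw [LinearMap.smul_comp, LinearMap.comp_smul]
    congr 1
    refine LinearMap.ext fun x => ?_
    rw [LinearMap.comp_apply, LinearMap.comp_apply, LinearMap.sum_apply, LinearMap.sum_apply, map_sum]
    refine Fintype.sum_equiv (Equiv.mulLeft τ⁻¹) _ _ fun σ => ?_
    change permRep ι d σ (g (X.ρ σ⁻¹ (X.ρ τ x))) =
      permRep ι d τ (permRep ι d (τ⁻¹ * σ) (g (X.ρ (τ⁻¹ * σ)⁻¹ x)))
    rw [← Module.End.mul_apply, ← Module.End.mul_apply, ← map_mul, ← map_mul, mul_inv_rev, inv_inv,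
      mul_inv_cancel_left]

lemma average_apply (g : X →ₗ[ℂ] (tensorRep ι d).carrier) (x : X) :
    average X g x = (Fintype.card (Equiv.Perm (Fin d)) : ℂ)⁻¹ •
      ∑ σ : Equiv.Perm (Fin d), permRep ι d σ (g (X.ρ σ⁻¹ x)) := by
  change ((Fintype.card (Equiv.Perm (Fin d)) : ℂ)⁻¹ •
    ∑ σ : Equiv.Perm (Fin d), permRep ι d σ ∘ₗ g ∘ₗ X.ρ σ⁻¹) x = _
  rw [LinearMap.smul_apply, LinearMap.sum_apply]
  rfl

lemma average_self (f : SWSpace ι X) : average X f.toLinearMap = f := by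
  refine Representation.IntertwiningMap.ext (LinearMap.ext fun x => ?_)
  change average X f.toLinearMap x = f x
  have h : ∀ σ : Equiv.Perm (Fin d), permRep ι d σ (f.toLinearMap (X.ρ σ⁻¹ x)) = f x := fun σ => by
    change permRep ι d σ (f (X.ρ σ⁻¹ x)) = f x
    rw [f.isIntertwining, ← Module.End.mul_apply, ← map_mul, mul_inv_cancel, map_one,
      Module.End.one_apply]
  rw [average_apply, Finset.sum_congr rfl fun σ _ => h σ, Finset.sum_const, Finset.card_univ,
    ← Nat.cast_smul_eq_nsmul ℂ, smul_smul, inv_mul_cancel₀, one_smul]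
  exact Nat.cast_ne_zero.mpr Fintype.card_ne_zero

/-- Evaluation at a vector. -/
def evalAt (x : X) : SWSpace ι X →ₗ⁅ℂ, gl ι⁆ (tensorRep ι d).carrier where
  toFun f := f x
  map_add' _ _ := rfl
  map_smul' _ _ := rfl
  map_lie' := rfl

/-- The average of the rank one map attached to a linear form. -/
def averageForm (l : X →ₗ[ℂ] ℂ) : (tensorRep ι d).carrier →ₗ⁅ℂ, gl ι⁆ SWSpace ι X where
  toFun t := average X (l.smulRight t)
  map_add' s t := by
    refine Representation.IntertwiningMap.ext (LinearMap.ext fun x => ?_)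
    change average X _ x = average X _ x + average X _ x
    simp only [average_apply, LinearMap.smulRight_apply, smul_add, map_add, Finset.sum_add_distrib]
  map_smul' c t := by
    refine Representation.IntertwiningMap.ext (LinearMap.ext fun x => ?_)
    change average X _ x = c • average X _ x
    simp only [average_apply, LinearMap.smulRight_apply, map_smul, Finset.smul_sum, smul_smul]
    refine Finset.sum_congr rfl fun σ _ => ?_
    congr 1
    ring
  map_lie' {A t} := by
    refine Representation.IntertwiningMap.ext (LinearMap.ext fun x => ?_)
    change average X _ x = ⁅A, average X _ x⁆
    simp only [average_apply, LinearMap.smulRight_apply, map_smul, lie_smul, lie_sum, permRep_lie]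

lemma sum_averageForm (f : SWSpace ι X) :
    ∑ k, averageForm X ((Module.finBasis ℂ X).coord k) (evalAt X (Module.finBasis ℂ X k) f) = f := by
  conv_rhs => rw [← average_self X f]
  refine Representation.IntertwiningMap.ext (LinearMap.ext fun x => ?_)
  rw [Representation.IntertwiningMap.toLinearMap_sum, LinearMap.sum_apply]
  change ∑ k, average X (((Module.finBasis ℂ X).coord k).smulRight (f (Module.finBasis ℂ X k))) x =
    average X f.toLinearMap x
  simp only [average_apply]
  rw [← Finset.smul_sum, Finset.sum_comm]
  congr 1
  refine Finset.sum_congr rfl fun σ _ => ?_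
  rw [← map_sum]
  congr 1
  conv_rhs => rw [← (Module.finBasis ℂ X).sum_repr (X.ρ σ⁻¹ x), map_sum]
  refine Finset.sum_congr rfl fun k _ => ?_
  rw [map_smul]
  rfl

lemma swSpace_eq_zero (hX : IsZero X) (f : SWSpace ι X) : f = 0 := by
  refine Representation.IntertwiningMap.ext (LinearMap.ext fun x => ?_)
  have h : toIntertwining (𝟙 X) = toIntertwining (0 : X ⟶ X) :=
    congrArg toIntertwining (hX.eq_of_src _ _)
  have hx : x = 0 := congrArg (fun g : Representation.IntertwiningMap X.ρ X.ρ => g x) h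
  rw [hx, map_zero, map_zero]

end SWPolynomial

lemma isPolynomial_sw (ι : Type) (X : SumRepSymᵒᵖ) : IsPolynomial ι ((swLieRep ι).obj X) := by
  classical
  let Y : ∀ d, RepSym d := X.unop.obj
  let s : Finset ℕ := Set.Finite.toFinset X.unop.property
  let J : Type := Σ d : s, Fin (Module.finrank ℂ (Y d.1))
  refine isPolynomial_of_sum_aux _ (J := J) (fun j => j.1.1)
    (fun j => (evalAt (Y j.1.1) (Module.finBasis ℂ (Y j.1.1) j.2)).comp
      (DirectSum.lieModuleComponent ℂ ℕ (gl ι)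
        (fun d => ((swDegree ι d).obj (Opposite.op (Y d))).carrier) j.1.1))
    (fun j => (DirectSum.lieModuleOf ℂ ℕ (gl ι)
        (fun d => ((swDegree ι d).obj (Opposite.op (Y d))).carrier) j.1.1).comp
      (averageForm (Y j.1.1) ((Module.finBasis ℂ (Y j.1.1)).coord j.2))) fun m => ?_
  let m' : ⨁ d, ((swDegree ι d).obj (Opposite.op (Y d))).carrier := m
  have hm : ∀ d, d ∉ s → m' d = 0 := fun d hd => by
    have hz : IsZero (Y d) := by
      by_contra h
      exact hd ((Set.Finite.mem_toFinset _).mpr h)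
    exact swSpace_eq_zero (Y d) hz _
  let o := fun d => DirectSum.lieModuleOf ℂ ℕ (gl ι)
    (fun d => ((swDegree ι d).obj (Opposite.op (Y d))).carrier) d
  change ∑ j : J, o j.1.1 (averageForm (Y j.1.1) ((Module.finBasis ℂ (Y j.1.1)).coord j.2)
    (evalAt (Y j.1.1) (Module.finBasis ℂ (Y j.1.1) j.2) (m' j.1.1))) = m'
  rw [Fintype.sum_sigma]
  have h1 : ∀ d : s, ∑ k, o d.1 (averageForm (Y d.1) ((Module.finBasis ℂ (Y d.1)).coord k)
      (evalAt (Y d.1) (Module.finBasis ℂ (Y d.1) k) (m' d.1))) = o d.1 (m' d.1) := fun d =>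
    (map_sum (o d.1) _ _).symm.trans (congrArg (o d.1) (sum_averageForm (Y d.1) (m' d.1)))
  refine (Finset.sum_congr rfl fun d _ => h1 d).trans ?_
  rw [Finset.sum_coe_sort s fun d => o d (m' d)]
  refine Eq.trans (Eq.symm ?_) (DirectSum.sum_support_of m')
  refine Finset.sum_subset (fun d hd => ?_) fun d _ hd => ?_
  · by_contra h
    exact (DFinsupp.mem_support_iff.mp hd) (hm d h)
  · rw [DFinsupp.notMem_support_iff.mp hd]
    exact map_zero (o d)

/-- The contravariant Schur–Weyl functor
`SW_{ℂ^N} = ⨁_d Hom_{S_d}(·, (ℂ^N)^{⊗ d}) : ⨁_d Rep(S_d) → Rep(𝔤𝔩_N)_poly`. -/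
def SW (ι : Type) : SumRepSymᵒᵖ ⥤ RepPoly ι :=
  (IsPolynomial ι).lift (swLieRep ι) (isPolynomial_sw ι)

/-- The functor `SW_∞`. -/
abbrev SWInfty : SumRepSymᵒᵖ ⥤ RepPoly ℕ := SW ℕ

/-! ### Compatibility of the Schur–Weyl functors with restriction -/

section Compat

variable (e : κ ↪ ι)

/-- Composition with the projection `(ℂ^ι)^{⊗ d} → (ℂ^κ)^{⊗ d}`. -/
def swProj (X : RepSym d) : SWSpace ι X →ₗ[ℂ] SWSpace κ X where
  toFun f := Representation.IntertwiningMap.comp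
    (⟨tproj e d, fun σ => LinearMap.ext fun t => permTPow_tensorMap σ (proj e) t⟩ :
      Representation.IntertwiningMap (permRep ι d) (permRep κ d)) f
  map_add' f g := Representation.IntertwiningMap.ext <| LinearMap.ext fun x =>
    map_add (tproj e d) (f x) (g x)
  map_smul' c f := Representation.IntertwiningMap.ext <| LinearMap.ext fun x =>
    map_smul (tproj e d) c (f x)

/-- Composition with the inclusion `(ℂ^κ)^{⊗ d} → (ℂ^ι)^{⊗ d}`. -/
def swIncl (X : RepSym d) : SWSpace κ X →ₗ[ℂ] SWSpace ι X where
  toFun f := Representation.IntertwiningMap.comp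
    (⟨tincl e d, fun σ => LinearMap.ext fun t => permTPow_tensorMap σ (incl e) t⟩ :
      Representation.IntertwiningMap (permRep κ d) (permRep ι d)) f
  map_add' f g := Representation.IntertwiningMap.ext <| LinearMap.ext fun x =>
    map_add (tincl e d) (f x) (g x)
  map_smul' c f := Representation.IntertwiningMap.ext <| LinearMap.ext fun x =>
    map_smul (tincl e d) c (f x)

lemma swProj_lie (X : RepSym d) (A : gl κ) (f : SWSpace ι X) :
    swProj e X ⁅glIncl e A, f⁆ = ⁅A, swProj e X f⁆ :=
  Representation.IntertwiningMap.ext <| LinearMap.ext fun x => tproj_lie e A (f x)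

lemma swIncl_lie (X : RepSym d) (A : gl κ) (f : SWSpace κ X) :
    swIncl e X ⁅A, f⁆ = ⁅glIncl e A, swIncl e X f⁆ :=
  Representation.IntertwiningMap.ext <| LinearMap.ext fun x => tincl_lie e A (f x)

lemma glPerp_swIncl (X : RepSym d) {B : gl ι} (hB : B ∈ glPerp e) (f : SWSpace κ X) :
    ⁅B, swIncl e X f⁆ = 0 :=
  Representation.IntertwiningMap.ext <| LinearMap.ext fun x => glPerp_tincl e hB (f x)

lemma swProj_swIncl (X : RepSym d) (f : SWSpace κ X) : swProj e X (swIncl e X f) = f :=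
  Representation.IntertwiningMap.ext <| LinearMap.ext fun x => tproj_tincl e (f x)

lemma swIncl_swProj (X : RepSym d) (f : SWSpace ι X) (hf : ∀ B ∈ glPerp e, ⁅B, f⁆ = 0) :
    swIncl e X (swProj e X f) = f :=
  Representation.IntertwiningMap.ext <| LinearMap.ext fun x => tincl_tproj e (f x) fun B hB =>
    congrArg (fun g : SWSpace ι X => g x) (hf B hB)

/-- The space underlying `SW_{ℂ^N}(X)`. -/
abbrev SWCarrier (ι : Type) (X : SumRepSymᵒᵖ) : Type :=
  ⨁ d, ((swDegree ι d).obj (Opposite.op (X.unop.obj d))).carrier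

/-- The isomorphism `SW_{ℂ^ι}(X)^{𝔤𝔩_κ^⊥} → SW_{ℂ^κ}(X)` given by the coordinate projection; its inverse
is given by the inclusion `ℂ^κ ⊆ ℂ^ι`. -/
def swResHom (X : SumRepSymᵒᵖ) : invariants e (SWCarrier ι X) →ₗ⁅ℂ, gl κ⁆ SWCarrier κ X where
  toFun m := DirectSum.lmap (fun d => swProj e (X.unop.obj d)) m.1
  map_add' m m' := map_add _ m.1 m'.1
  map_smul' c m := map_smul _ c m.1
  map_lie' {A m} := DFinsupp.ext fun d => swProj_lie e (X.unop.obj d) A (m.1 d)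

/-- The inverse of `swResHom`. -/
def swResInv (X : SumRepSymᵒᵖ) : SWCarrier κ X →ₗ⁅ℂ, gl κ⁆ invariants e (SWCarrier ι X) where
  toFun m := ⟨DirectSum.lmap (fun d => swIncl e (X.unop.obj d)) m, fun _ hB =>
    DFinsupp.ext fun d => glPerp_swIncl e (X.unop.obj d) hB (m d)⟩
  map_add' m m' := Subtype.ext (map_add _ m m')
  map_smul' c m := Subtype.ext (map_smul _ c m)
  map_lie' {A m} := Subtype.ext (DFinsupp.ext fun d => swIncl_lie e (X.unop.obj d) A (m d))

lemma swResInv_swResHom (X : SumRepSymᵒᵖ) (m : invariants e (SWCarrier ι X)) :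
    swResInv e X (swResHom e X m) = m :=
  Subtype.ext <| DFinsupp.ext fun d => swIncl_swProj e (X.unop.obj d) (m.1 d) fun B hB =>
    congrArg (fun g : SWCarrier ι X => g d) (m.2 B hB)

lemma swResHom_swResInv (X : SumRepSymᵒᵖ) (m : SWCarrier κ X) :
    swResHom e X (swResInv e X m) = m :=
  DFinsupp.ext fun d => swProj_swIncl e (X.unop.obj d) (m d)

/-- The natural isomorphism `(·)^{𝔤𝔩_κ^⊥} ∘ SW_{ℂ^ι} ≅ SW_{ℂ^κ}`. -/
def swResIso : SW ι ⋙ resPoly e ≅ SW κ :=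
  NatIso.ofComponents
    (fun X => ObjectProperty.isoMk _
      { hom := swResHom e X
        inv := swResInv e X
        hom_inv_id := LieModuleHom.ext (swResInv_swResHom e X)
        inv_hom_id := LieModuleHom.ext (swResHom_swResInv e X) })
    (fun _ => ObjectProperty.hom_ext _ (LieModuleHom.ext fun _ => DFinsupp.ext fun _ => rfl))

end Compat

/-! ### Inverse limits and restricted inverse limits of categories -/

section InverseLimit

universe v u

variable (C : ℕ → Type u) [∀ n, Category.{v} (C n)] (F : ∀ n, C (n + 1) ⥤ C n)

/-- Objects of the inverse limit of the system `⋯ ⥤ C 2 ⥤ C 1 ⥤ C 0`: sequences of objects `X_n` with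
isomorphisms `F(X_{n+1}) ≅ X_n`. -/
structure InvLim where
  obj : ∀ n, C n
  iso : ∀ n, (F n).obj (obj (n + 1)) ≅ obj n

variable {C F}

/-- Morphisms of the inverse limit: sequences of morphisms compatible with the isomorphisms. -/
@[ext]
structure InvLim.Hom (X Y : InvLim C F) where
  app : ∀ n, X.obj n ⟶ Y.obj n
  comm : ∀ n, (F n).map (app (n + 1)) ≫ (Y.iso n).hom = (X.iso n).hom ≫ app n

instance : Category (InvLim C F) where
  Hom X Y := InvLim.Hom X Y
  id X := ⟨fun n => 𝟙 _, fun n => by simp⟩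
  comp f g := ⟨fun n => f.app n ≫ g.app n, fun n => by
    rw [Functor.map_comp, Category.assoc, g.comm, ← Category.assoc, f.comm, Category.assoc]⟩

@[ext]
lemma InvLim.hom_ext {X Y : InvLim C F} {f g : X ⟶ Y} (h : ∀ n, f.app n = g.app n) : f = g :=
  InvLim.Hom.ext (funext h)

/-- The (Jordan–Hölder) length of an object: the supremum of the lengths of chains of subobjects. -/
def objectLength {D : Type u} [Category.{v} D] (X : D) : ℕ∞ := Order.height (⊤ : Subobject X)

variable (C F)

/-- The objects `(X_n)_n` of the inverse limit such that the lengths of the `X_n` are bounded. -/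
def BoundedLength : ObjectProperty (InvLim C F) := fun X => ∃ l : ℕ, ∀ n, objectLength (X.obj n) ≤ l

/-- The restricted inverse limit. -/
abbrev RestrInvLim : Type (max u v) := (BoundedLength C F).FullSubcategory

variable {C F}

/-- The functor to the inverse limit induced by compatible functors to the terms of the system. -/
def InvLim.lift {D : Type*} [Category* D] (G : ∀ n, D ⥤ C n) (α : ∀ n, G (n + 1) ⋙ F n ≅ G n) :
    D ⥤ InvLim C F where
  obj X := ⟨fun n => (G n).obj X, fun n => (α n).app X⟩
  map f := ⟨fun n => (G n).map f, fun n => (α n).hom.naturality f⟩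
  map_id X := InvLim.hom_ext fun n => (G n).map_id X
  map_comp f g := InvLim.hom_ext fun n => (G n).map_comp f g

variable [∀ n, Preadditive (C n)] [∀ n, (F n).Additive]

instance (X Y : InvLim C F) : Zero (X ⟶ Y) := ⟨⟨fun _ => 0, fun n => by simp⟩⟩

instance (X Y : InvLim C F) : Add (X ⟶ Y) :=
  ⟨fun f g => ⟨fun n => f.app n + g.app n, fun n => by
    rw [Functor.map_add, Preadditive.add_comp, Preadditive.comp_add, f.comm, g.comm]⟩⟩

instance (X Y : InvLim C F) : Neg (X ⟶ Y) :=
  ⟨fun f => ⟨fun n => -f.app n, fun n => by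
    rw [Functor.map_neg, Preadditive.neg_comp, Preadditive.comp_neg, f.comm]⟩⟩

instance : Preadditive (InvLim C F) where
  homGroup X Y :=
    { add_assoc := fun f g h => InvLim.hom_ext fun n => add_assoc (f.app n) (g.app n) (h.app n)
      zero_add := fun f => InvLim.hom_ext fun n => zero_add (f.app n)
      add_zero := fun f => InvLim.hom_ext fun n => add_zero (f.app n)
      nsmul := nsmulRec
      zsmul := zsmulRec
      neg_add_cancel := fun f => InvLim.hom_ext fun n => neg_add_cancel (f.app n)
      add_comm := fun f g => InvLim.hom_ext fun n => add_comm (f.app n) (g.app n) }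
  add_comp _ _ _ f f' g := InvLim.hom_ext fun n => Preadditive.add_comp _ _ _ (f.app n) (f'.app n) (g.app n)
  comp_add _ _ _ f g g' := InvLim.hom_ext fun n => Preadditive.comp_add _ _ _ (f.app n) (g.app n) (g'.app n)

variable [∀ n, Linear ℂ (C n)] [∀ n, (F n).Linear ℂ]

instance (X Y : InvLim C F) : SMul ℂ (X ⟶ Y) :=
  ⟨fun c f => ⟨fun n => c • f.app n, fun n => by
    rw [Functor.map_smul, Linear.smul_comp, Linear.comp_smul, f.comm]⟩⟩

instance : Linear ℂ (InvLim C F) where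
  homModule X Y :=
    { one_smul := fun f => InvLim.hom_ext fun n => one_smul ℂ (f.app n)
      mul_smul := fun c c' f => InvLim.hom_ext fun n => mul_smul c c' (f.app n)
      smul_zero := fun c => InvLim.hom_ext fun n => smul_zero (A := X.obj n ⟶ Y.obj n) c
      smul_add := fun c f g => InvLim.hom_ext fun n => smul_add c (f.app n) (g.app n)
      add_smul := fun c c' f => InvLim.hom_ext fun n => add_smul c c' (f.app n)
      zero_smul := fun f => InvLim.hom_ext fun n => zero_smul ℂ (f.app n) }
  smul_comp _ _ _ c f g := InvLim.hom_ext fun n => Linear.smul_comp _ _ _ c (f.app n) (g.app n)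
  comp_smul _ _ _ f c g := InvLim.hom_ext fun n => Linear.comp_smul _ _ _ (f.app n) c (g.app n)

end InverseLimit

/-- Addition of morphisms in a product of preadditive categories is componentwise. -/
instance piPreadditive {I : Type} (C : I → Type 1) [∀ i, Category.{0} (C i)] [∀ i, Preadditive (C i)] :
    Preadditive (∀ i, C i) where
  homGroup X Y := inferInstanceAs (AddCommGroup (∀ i, X i ⟶ Y i))
  add_comp _ _ _ f f' g := funext fun i => Preadditive.add_comp _ _ _ (f i) (f' i) (g i)
  comp_add _ _ _ f g g' := funext fun i => Preadditive.comp_add _ _ _ (f i) (g i) (g' i)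

/-- Scalar multiplication of morphisms in a product of linear categories is componentwise. -/
instance piLinear {I : Type} (C : I → Type 1) [∀ i, Category.{0} (C i)] [∀ i, Preadditive (C i)]
    [∀ i, Linear ℂ (C i)] : Linear ℂ (∀ i, C i) where
  homModule X Y := inferInstanceAs (Module ℂ (∀ i, X i ⟶ Y i))
  smul_comp _ _ _ c f g := funext fun i => Linear.smul_comp _ _ _ c (f i) (g i)
  comp_smul _ _ _ f c g := funext fun i => Linear.comp_smul _ _ _ (f i) c (g i)

/-- A contravariant functor between `ℂ`-linear categories is an anti-equivalence (of `ℂ`-linear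
categories) if it is an equivalence from the opposite category and is additive and `ℂ`-linear on
morphisms. -/
structure IsAntiEquivalence {D E : Type*} [Category* D] [Category* E] [Preadditive D] [Preadditive E]
    [Linear ℂ D] [Linear ℂ E] (G : Dᵒᵖ ⥤ E) : Prop where
  isEquivalence : G.IsEquivalence
  map_add : ∀ {X Y : D} (f g : X ⟶ Y), G.map (f + g).op = G.map f.op + G.map g.op
  map_smul : ∀ {X Y : D} (c : ℂ) (f : X ⟶ Y), G.map (c • f).op = c • G.map f.op

/-- A preadditive category is semisimple if it is abelian and every object is a finite direct sum of
simple objects. -/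
def IsSemisimpleCategory (D : Type*) [Category* D] [P : Preadditive D] : Prop :=
  (∃ A : Abelian D, A.toPreadditive = P) ∧
    ∀ X : D, ∃ (n : ℕ) (S : Fin n → D) (b : Bicone S),
      (∀ i, Simple (S i)) ∧ Nonempty b.IsBilimit ∧ Nonempty (b.pt ≅ X)

/-! ### The system of categories `Rep(𝔤𝔩_n)_poly` -/

/-- The category `Rep(𝔤𝔩_n)_poly` for a natural number `n`. -/
abbrev RepPolyFin (n : ℕ) : Type 1 := RepPoly (Fin n)

/-- The restriction functor `Res_{n, n+1} = (·)^{𝔤𝔩_n^⊥}`. -/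
abbrev Res (n : ℕ) : RepPolyFin (n + 1) ⥤ RepPolyFin n := resPoly Fin.castSuccEmb

instance (e : κ ↪ ι) : (resPoly e).Additive where
  map_add := ObjectProperty.hom_ext _ (LieModuleHom.ext fun _ => rfl)

instance (e : κ ↪ ι) : (resPoly e).Linear ℂ where
  map_smul _ _ := ObjectProperty.hom_ext _ (LieModuleHom.ext fun _ => rfl)

/-- The functor to the inverse limit of the `Rep(𝔤𝔩_n)_poly` induced by the functors `SW_{ℂ^n}` and the
isomorphisms `Res_{n, n+1} ∘ SW_{ℂ^{n+1}} ≅ SW_{ℂ^n}`. -/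
def SWInvLim : SumRepSymᵒᵖ ⥤ InvLim RepPolyFin Res :=
  InvLim.lift (fun n => SW (Fin n)) fun _ => swResIso Fin.castSuccEmb

/-- The restricted inverse limit of the categories `Rep(𝔤𝔩_n)_poly`. -/
abbrev RestrRepPoly : Type 1 := RestrInvLim RepPolyFin Res

end SchurWeyl

end

/-!
A homomorphism out of `(ℂ^N)^{⊗ d}` maps a tensor `e_w` of basis vectors to a vector of the same
weight for the diagonal matrices. So there is no nonzero homomorphism to `(ℂ^N)^{⊗ d'}` for
`d' ≠ d`, and if `w` is injective, an endomorphism maps `e_w` to a combination of its permutations.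
When `N ≥ 3d`, matrix units carry `e_w` to every other basis vector by way of indices not yet in
use, so the permutations span the endomorphisms. Hence `SW_N` is fully faithful in degrees at most
`D` when `N ≥ 3D`.

Every summand of tensor powers of degrees at most `D` is a summand of a power of `SW_N(R_D)`, where
`R_D` is the sum of the regular representations of `S_d` for `d ≤ D`. As idempotents split, it lies
in the essential image of `SW_N`, which gives the anti-equivalence for `N = ∞`.

In the inverse limit, a degree that occurs in `M_n` occurs in all later terms, and the number of
degrees that occur in `M_n` is at most the length of `M_n`, so bounded lengths bound the degrees.
Conversely, the length of `SW_n(X)` is at most the dimension of `Hom(SW_n(R_D), SW_n(X))`, which for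
`n ≥ 3D` is at most that of `Hom(X, R_D)`.

Semisimplicity of `⨁ Rep(S_d)` is Maschke's theorem: every morphism has a pseudo-inverse, so
kernels, cokernels and complements come from split idempotents. The anti-equivalences carry it over
to the other two categories.
-/

noncomputable section

namespace SchurWeyl

attribute [local instance] LieRing.ofAssociativeRing

/-! ### Regular categories and semisimplicity -/

section Regular

universe v u

/-- Von Neumann regularity, the analogue for categories of the regularity of rings: every morphism
has a pseudo-inverse. -/
def IsVonNeumannRegular (C : Type u) [Category.{v} C] : Prop :=
  ∀ ⦃X Y : C⦄ (f : X ⟶ Y), ∃ g : Y ⟶ X, f ≫ g ≫ f = f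

variable {C : Type u} [Category.{v} C]

lemma IsVonNeumannRegular.isSplitMono (h : IsVonNeumannRegular C) {X Y : C} (f : X ⟶ Y) [Mono f] :
    IsSplitMono f := by
  obtain ⟨g, hg⟩ := h f
  exact ⟨⟨g, by rw [← cancel_mono f, Category.assoc, hg, Category.id_comp]⟩⟩

lemma IsVonNeumannRegular.isSplitEpi (h : IsVonNeumannRegular C) {X Y : C} (f : X ⟶ Y) [Epi f] :
    IsSplitEpi f := by
  obtain ⟨g, hg⟩ := h f
  exact ⟨⟨g, by rw [← cancel_epi f, hg, Category.comp_id]⟩⟩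

variable [Preadditive C]

lemma IsVonNeumannRegular.hasKernels [IsIdempotentComplete C] (h : IsVonNeumannRegular C) :
    HasKernels C where
  has_limit {X Y} f := by
    obtain ⟨g, hg⟩ := h f
    obtain ⟨K, i, r, hir, hri⟩ := IsIdempotentComplete.idempotents_split X (𝟙 X - f ≫ g)
      (by simp [Preadditive.sub_comp, Preadditive.comp_sub, reassoc_of% hg])
    have : Mono i := (SplitMono.mk r hir).mono
    have hif : i ≫ f = 0 := by
      have hf : (r ≫ i) ≫ f = 0 := by simp [hri, Preadditive.sub_comp, hg]
      simpa [reassoc_of% hir] using i ≫= hf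
    exact ⟨⟨KernelFork.ofι i hif, KernelFork.IsLimit.ofι' i hif fun {A} k hk => ⟨k ≫ r, by
      simp [hri, Preadditive.comp_sub, reassoc_of% hk]⟩⟩⟩

lemma IsVonNeumannRegular.hasCokernels [IsIdempotentComplete C] (h : IsVonNeumannRegular C) :
    HasCokernels C where
  has_colimit {X Y} f := by
    obtain ⟨g, hg⟩ := h f
    obtain ⟨Q, i, r, hir, hri⟩ := IsIdempotentComplete.idempotents_split Y (𝟙 Y - g ≫ f)
      (by simp [Preadditive.sub_comp, Preadditive.comp_sub, hg])
    have : Epi r := (SplitEpi.mk i hir).epi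
    have hfr : f ≫ r = 0 := by
      have hf : f ≫ r ≫ i = 0 := by simp [hri, Preadditive.comp_sub, hg]
      simpa [hir] using hf =≫ r
    exact ⟨⟨CokernelCofork.ofπ r hfr, CokernelCofork.IsColimit.ofπ' r hfr fun {A} k hk =>
      ⟨i ≫ k, by simp [reassoc_of% hri, Preadditive.sub_comp, hk]⟩⟩⟩

lemma isNormalMonoCategory_of_isSplitMono (h : ∀ ⦃X Y : C⦄ (f : X ⟶ Y) [Mono f], IsSplitMono f) :
    IsNormalMonoCategory C where
  normalMonoOfMono {X Y} f _ := by
    have := h f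
    have hf : f ≫ (𝟙 Y - retraction f ≫ f) = 0 := by simp [Preadditive.comp_sub]
    exact ⟨⟨Y, _, hf, KernelFork.IsLimit.ofι' f hf fun {A} k hk => ⟨k ≫ retraction f, by
      rw [Preadditive.comp_sub, Category.comp_id, sub_eq_zero] at hk
      rw [Category.assoc, ← hk]⟩⟩⟩

lemma isNormalEpiCategory_of_isSplitEpi (h : ∀ ⦃X Y : C⦄ (f : X ⟶ Y) [Epi f], IsSplitEpi f) :
    IsNormalEpiCategory C where
  normalEpiOfEpi {X Y} f _ := by
    have := h f
    have hf : (𝟙 X - f ≫ section_ f) ≫ f = 0 := by simp [Preadditive.sub_comp]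
    exact ⟨⟨X, _, hf, CokernelCofork.IsColimit.ofπ' f hf fun {A} k hk => ⟨section_ f ≫ k, by
      rw [Preadditive.sub_comp, Category.id_comp, sub_eq_zero] at hk
      rw [← Category.assoc, ← hk]⟩⟩⟩

lemma IsVonNeumannRegular.exists_abelian [IsIdempotentComplete C] [HasFiniteProducts C]
    (h : IsVonNeumannRegular C) : ∃ A : Abelian C, A.toPreadditive = ‹Preadditive C› := by
  have := h.hasKernels
  have := h.hasCokernels
  have := isNormalMonoCategory_of_isSplitMono fun _ _ f _ => h.isSplitMono f
  have := isNormalEpiCategory_of_isSplitEpi fun _ _ f _ => h.isSplitEpi f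
  exact ⟨{}, rfl⟩

lemma finrank_end_lt_of_retract {k : Type*} [Field k] [Linear k C] {A X : C}
    [FiniteDimensional k (X ⟶ X)] (h : Retract A X) (hne : h.r ≫ h.i ≠ 𝟙 X) :
    Module.finrank k (A ⟶ A) < Module.finrank k (X ⟶ X) := by
  let φ : (A ⟶ A) →ₗ[k] (X ⟶ X) := Linear.leftComp k X h.r ∘ₗ Linear.rightComp k A h.i
  have hφ : Function.Injective φ := fun f g hfg => by
    have hfg : h.i ≫ (h.r ≫ f ≫ h.i) ≫ h.r = h.i ≫ (h.r ≫ g ≫ h.i) ≫ h.r :=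
      congrArg (fun m => h.i ≫ m ≫ h.r) hfg
    simpa using hfg
  rw [← LinearMap.finrank_range_of_inj hφ]
  refine Submodule.finrank_lt fun htop => hne ?_
  obtain ⟨f, hf⟩ := LinearMap.range_eq_top.1 htop (𝟙 X)
  have hf : h.r ≫ f ≫ h.i = 𝟙 X := hf
  calc h.r ≫ h.i = (h.r ≫ h.i) ≫ h.r ≫ f ≫ h.i := by rw [hf, Category.comp_id]
    _ = 𝟙 X := by simpa using hf

/-- The object `X` is a finite product, hence in a preadditive category a finite direct sum, of
simple objects. -/
def IsSumOfSimples (X : C) : Prop :=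
  ∃ (J : Type) (_ : Finite J) (S : J → C) (π : ∀ j, X ⟶ S j),
    (∀ j, Simple (S j)) ∧ Nonempty (IsLimit (Fan.mk X π))

lemma IsSumOfSimples.of_isZero {X : C} (hX : IsZero X) : IsSumOfSimples X :=
  ⟨Empty, inferInstance, Empty.elim, fun j => j.elim, fun j => j.elim,
    ⟨Fan.IsLimit.mk _ (fun _ => 0) (fun _ j => j.elim) fun _ _ _ => hX.eq_of_tgt _ _⟩⟩

lemma IsSumOfSimples.of_simple (X : C) [Simple X] : IsSumOfSimples X :=
  ⟨Unit, inferInstance, fun _ => X, fun _ => 𝟙 X, fun _ => inferInstance,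
    ⟨Fan.IsLimit.mk _ (fun s => s.proj ()) (fun _ _ => Category.comp_id _) fun s m hm => by
      simpa using hm ()⟩⟩

lemma IsSumOfSimples.of_isBilimit {X Y : C} {b : BinaryBicone X Y} (hb : b.IsBilimit)
    (hX : IsSumOfSimples X) (hY : IsSumOfSimples Y) : IsSumOfSimples b.pt := by
  obtain ⟨J, _, S, π, hS, ⟨hπ⟩⟩ := hX
  obtain ⟨K, _, T, ρ, hT, ⟨hρ⟩⟩ := hY
  exact ⟨J ⊕ K, inferInstance, Sum.elim S T, _, Sum.rec hS hT,
    ⟨Fan.combPairIsLimit hπ hρ hb.isLimit⟩⟩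

lemma IsSumOfSimples.exists_bicone {X : C} (hX : IsSumOfSimples X) :
    ∃ (n : ℕ) (S : Fin n → C) (b : Bicone S),
      (∀ i, Simple (S i)) ∧ Nonempty b.IsBilimit ∧ Nonempty (b.pt ≅ X) := by
  classical
  obtain ⟨J, _, S, π, hS, ⟨hπ⟩⟩ := hX
  have := Fintype.ofFinite J
  have ε := (Finite.equivFin J).symm
  exact ⟨_, S ∘ ε, (Bicone.ofLimitCone hπ).whisker ε, fun _ => hS _,
    ⟨(Bicone.whiskerIsBilimitIff _ ε).symm (biconeIsBilimitOfLimitConeOfIsLimit hπ)⟩,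
    ⟨Iso.refl X⟩⟩

lemma inl_eq_zero_of_snd_comp_inr {X Y : C} (b : BinaryBicone X Y)
    (h : b.snd ≫ b.inr = 𝟙 b.pt) : b.inl = 0 := by
  rw [← Category.comp_id b.inl, ← h, b.inl_snd_assoc, zero_comp]

/-- Proper direct summands have smaller endomorphism algebras. -/
lemma isSumOfSimples_of_isSplitMono {k : Type*} [Field k] [HasCokernels C] [Linear k C]
    [∀ X : C, FiniteDimensional k (X ⟶ X)]
    (h : ∀ ⦃X Y : C⦄ (f : X ⟶ Y) [Mono f], IsSplitMono f) (X : C) : IsSumOfSimples X := by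
  induction hn : Module.finrank k (X ⟶ X) using Nat.strong_induction_on generalizing X with
  | _ n ih =>
    subst hn
    by_cases hX : IsZero X
    · exact .of_isZero hX
    by_cases hs : Simple X
    · exact .of_simple X
    obtain ⟨Y, f, hf, hf0, hfiso⟩ : ∃ (Y : C) (f : Y ⟶ X), Mono f ∧ f ≠ 0 ∧ ¬ IsIso f := by
      by_contra! hall
      refine hs ⟨fun {Y} f _ => ⟨fun hiso hf => hX ?_, hall Y f inferInstance⟩⟩
      subst hf
      exact (IsZero.iff_id_eq_zero X).2 (by rw [← IsIso.inv_hom_id (0 : Y ⟶ X), comp_zero])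
    have := h f
    have hb := isBilimitBinaryBiconeOfIsSplitMonoOfCokernel (cokernelIsCokernel f)
    set b := binaryBiconeOfIsSplitMonoOfCokernel (cokernelIsCokernel f)
    refine IsSumOfSimples.of_isBilimit hb
      (ih _ (finrank_end_lt_of_retract ⟨b.inl, b.fst, b.inl_fst⟩ fun h1 => hfiso ?_) _ rfl)
      (ih _ (finrank_end_lt_of_retract ⟨b.inr, b.snd, b.inr_snd⟩ fun h1 => hf0 ?_) _ rfl)
    · exact ⟨b.fst, b.inl_fst, h1⟩
    · exact inl_eq_zero_of_snd_comp_inr b h1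

lemma IsVonNeumannRegular.isSemisimpleCategory (k : Type*) [Field k] [Linear k C]
    [∀ X : C, FiniteDimensional k (X ⟶ X)] [IsIdempotentComplete C] [HasFiniteProducts C]
    (h : IsVonNeumannRegular C) : IsSemisimpleCategory C := by
  have := h.hasCokernels
  exact ⟨h.exists_abelian, fun X => (isSumOfSimples_of_isSplitMono (k := k)
    (fun _ _ f _ => h.isSplitMono f) X).exists_bicone⟩

end Regular

section AntiEquivalence

variable {D E : Type*} [Category* D] [Category* E]

lemma simple_op [Abelian D] (X : D) [Simple X] : Simple (Opposite.op X) :=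
  simple_of_cosimple _ fun f _ => by
    have hf : f.unop = 0 ↔ f = 0 :=
      ⟨fun hf => Quiver.Hom.unop_inj hf, fun hf => by rw [hf, unop_zero]⟩
    rw [← isIso_unop_iff, ne_eq, ← hf]
    exact Simple.mono_isIso_iff_nonzero (X := X) f.unop

/-- The opposite of a bicone, with the projections and the inclusions interchanged. -/
@[simps]
def opBicone [HasZeroMorphisms D] {J : Type*} {S : J → D} (b : Bicone S) :
    Bicone fun j => Opposite.op (S j) where
  pt := Opposite.op b.pt
  π j := (b.ι j).op
  ι j := (b.π j).op
  ι_π j k := by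
    rw [← op_comp, b.ι_π]
    split_ifs with hkj hjk hjk
    · subst hkj
      simp
    · exact absurd hkj.symm hjk
    · exact absurd hjk.symm hkj
    · rfl

lemma nonempty_isBilimit_opBicone [Preadditive D] {J : Type*} [Finite J] {S : J → D}
    {b : Bicone S} (hb : b.IsBilimit) : Nonempty (opBicone b).IsBilimit :=
  have := Fintype.ofFinite J
  ⟨isBilimitOfTotal _ (Quiver.Hom.unop_inj ((unop_sum _ _ _ _).trans (IsBilimit.total hb)))⟩

variable [Preadditive D] [Preadditive E] [Linear ℂ D] [Linear ℂ E]

lemma IsSemisimpleCategory.of_isAntiEquivalence (hD : IsSemisimpleCategory D) {G : Dᵒᵖ ⥤ E}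
    (hG : IsAntiEquivalence G) : IsSemisimpleCategory E := by
  have := hG.isEquivalence
  have : G.Additive := ⟨fun {X Y f g} => hG.map_add f.unop g.unop⟩
  obtain ⟨⟨_, rfl⟩, hsum⟩ := hD
  have : HasFiniteProducts E := ⟨fun n => Adjunction.hasLimitsOfShape_of_equivalence G.inv⟩
  refine ⟨⟨abelianOfEquivalence G.inv, rfl⟩, fun Y => ?_⟩
  obtain ⟨n, S, b, hS, ⟨hb⟩, ⟨e⟩⟩ := hsum (G.objPreimage Y).unop
  obtain ⟨hb⟩ := nonempty_isBilimit_opBicone hb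
  refine ⟨n, fun i => G.obj (Opposite.op (S i)), G.mapBicone (opBicone b), fun i => ?_, ⟨?_⟩, ⟨?_⟩⟩
  · have := simple_op (S i)
    exact simple_obj G _
  · exact isBilimitOfPreserves G hb
  · exact G.mapIso e.op.symm ≪≫ G.objObjPreimageIso Y

end AntiEquivalence

section Regular

universe v u

variable {C : Type u} [Category.{v} C]

lemma isVonNeumannRegular_of_injective_of_projective [Abelian C] [∀ X : C, Injective X]
    [∀ X : C, Projective X] : IsVonNeumannRegular C := fun X Y f => by
  obtain ⟨r, hr⟩ := Injective.factors (𝟙 _) (image.ι f)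
  obtain ⟨s, hs⟩ := Projective.factors (𝟙 _) (factorThruImage f)
  refine ⟨r ≫ s, ?_⟩
  calc f ≫ (r ≫ s) ≫ f
      = (factorThruImage f ≫ image.ι f) ≫ (r ≫ s) ≫ factorThruImage f ≫ image.ι f := by
        rw [image.fac]
    _ = factorThruImage f ≫ (image.ι f ≫ r) ≫ (s ≫ factorThruImage f) ≫ image.ι f := by
        simp only [Category.assoc]
    _ = f := by rw [hr, hs, Category.id_comp, Category.id_comp, image.fac]

instance isIdempotentComplete_fullSubcategory [IsIdempotentComplete C] (P : ObjectProperty C)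
    [P.IsStableUnderRetracts] : IsIdempotentComplete P.FullSubcategory where
  idempotents_split X e he := by
    obtain ⟨A, i, r, hir, hri⟩ := IsIdempotentComplete.idempotents_split X.obj e.hom
      (congrArg (·.hom) he)
    exact ⟨⟨A, P.prop_of_retract ⟨i, r, hir⟩ X.property⟩, P.homMk i, P.homMk r,
      P.hom_ext hir, P.hom_ext hri⟩

instance isIdempotentComplete_pi {I : Type*} (D : I → Type*) [∀ i, Category* (D i)]
    [∀ i, IsIdempotentComplete (D i)] : IsIdempotentComplete (∀ i, D i) where
  idempotents_split X e he := by
    choose A i r hir hri using fun d =>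
      IsIdempotentComplete.idempotents_split (X d) (e d) (congrFun he d)
    exact ⟨A, i, r, funext hir, funext hri⟩

end Regular

/-! ### Families of representations of the symmetric groups -/

instance (d : ℕ) : IsIdempotentComplete (RepSym d) :=
  Idempotents.isIdempotentComplete_of_abelian _

lemma isVonNeumannRegular_repSym (d : ℕ) : IsVonNeumannRegular (RepSym d) :=
  isVonNeumannRegular_of_injective_of_projective

instance : FinitelySupported.IsStableUnderRetracts where
  of_retract h hY := hY.subset fun d hd hYd => hd <| (IsZero.iff_id_eq_zero _).2 <|
    calc 𝟙 _ = h.i d ≫ h.r d := (congrFun h.retract d).symm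
      _ = 0 := by rw [hYd.eq_of_tgt (h.i d) 0, zero_comp]

lemma isZero_pi_apply_of_isLimit {I : Type*} {D : I → Type*} [∀ i, Category* (D i)]
    [∀ i, HasZeroMorphisms (D i)] {J : Type*} [Category* J] {F : J ⥤ ∀ i, D i} {c : Cone F}
    (hc : IsLimit c) {i : I} (h : ∀ j, IsZero (F.obj j i)) : IsZero (c.pt i) := by
  classical
  have key : Function.update (𝟙 c.pt) i 0 = 𝟙 c.pt := hc.hom_ext fun j => funext fun i' => by
    obtain rfl | hi := eq_or_ne i' i
    · exact (h j).eq_of_tgt _ _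
    · simp [hi]
  exact (IsZero.iff_id_eq_zero _).2 (by simpa using (congrFun key i).symm)

instance : FinitelySupported.IsClosedUnderFiniteProducts where
  isClosedUnderLimitsOfShape J _ := ⟨by
    rintro X ⟨p⟩
    refine (Set.finite_iUnion fun j : J => p.prop_diag_obj ⟨j⟩).subset fun d hd => ?_
    by_contra hall
    refine hd (isZero_pi_apply_of_isLimit p.isLimit fun j => ?_)
    by_contra hj
    exact hall (Set.mem_iUnion.2 ⟨j.as, hj⟩)⟩

instance : HasFiniteProducts (∀ d, RepSym d) where
  out _ := ⟨fun _ => pi.hasLimit_of_hasLimit_comp_eval⟩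

lemma isVonNeumannRegular_sumRepSym : IsVonNeumannRegular SumRepSym := fun X Y f => by
  choose g hg using fun d => isVonNeumannRegular_repSym d (f.hom d)
  exact ⟨FinitelySupported.homMk g, FinitelySupported.hom_ext (funext hg)⟩

/-- A morphism between finitely supported families is determined by its components on the
support of the source. -/
instance (X Y : SumRepSym) : FiniteDimensional ℂ (X ⟶ Y) := by
  have := X.property.to_subtype
  let φ : (X ⟶ Y) →ₗ[ℂ] ∀ d : {d | ¬ IsZero (X.obj d)}, X.obj d ⟶ Y.obj d :=
    { toFun := fun f d => f.hom d
      map_add' := fun _ _ => rfl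
      map_smul' := fun _ _ => rfl }
  refine FiniteDimensional.of_injective φ fun f g hfg =>
    FinitelySupported.hom_ext (funext fun d => ?_)
  by_cases hd : IsZero (X.obj d)
  · exact hd.eq_of_src _ _
  · exact congrFun hfg ⟨d, hd⟩

theorem isSemisimpleCategory_sumRepSym : IsSemisimpleCategory SumRepSym :=
  isVonNeumannRegular_sumRepSym.isSemisimpleCategory ℂ

/-! ### Lengths and summands of powers -/

section Length

universe v u

variable {C : Type u} [Category.{v} C]

lemma mk_le_mk_iff_of_retract {A B X : C} (h : Retract A X) (h' : Retract B X) :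
    Subobject.mk h.i ≤ Subobject.mk h'.i ↔ (h.r ≫ h.i) ≫ h'.r ≫ h'.i = h.r ≫ h.i := by
  refine ⟨fun hle => ?_, fun heq => Subobject.mk_le_mk_of_comm (h.i ≫ h'.r) ?_⟩
  · have hi : h.i ≫ h'.r ≫ h'.i = h.i :=
      calc h.i ≫ h'.r ≫ h'.i = (Subobject.ofMkLEMk _ _ hle ≫ h'.i) ≫ h'.r ≫ h'.i := by
            rw [Subobject.ofMkLEMk_comp]
        _ = Subobject.ofMkLEMk _ _ hle ≫ h'.i := by
            simp only [Category.assoc, Retract.retract_assoc]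
        _ = h.i := Subobject.ofMkLEMk_comp hle
    rw [Category.assoc, hi]
  · simpa using h.i ≫= heq

variable [Preadditive C]

lemma card_le_height {I : Type*} (T : Finset I) : (T.card : ℕ∞) ≤ Order.height T := by
  classical
  induction T using Finset.induction_on with
  | empty => simp
  | insert k T hk ih =>
    rw [Finset.card_insert_of_notMem hk, Nat.cast_add, Nat.cast_one]
    exact (add_le_add_left ih 1).trans (Order.height_add_one_le (Finset.ssubset_insert hk))

lemma sum_mul_sum_eq_iff_subset {R I : Type*} [Semiring R] {e : I → R}
    (he : OrthogonalIdempotents e) (h0 : ∀ k, e k ≠ 0) {T U : Finset I} :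
    (∑ k ∈ U, e k) * ∑ k ∈ T, e k = ∑ k ∈ T, e k ↔ T ⊆ U := by
  refine ⟨fun h k hk => ?_, fun h => ?_⟩
  · by_contra hkU
    refine h0 k ?_
    rw [← he.mul_sum_of_mem hk, ← h, ← mul_assoc, he.mul_sum_of_notMem hkU, zero_mul]
  · rw [Finset.sum_mul, ← Finset.sum_subset h fun k _ hk => he.mul_sum_of_notMem hk]
    exact Finset.sum_congr rfl fun k hk => he.mul_sum_of_mem hk

lemma card_le_objectLength [IsIdempotentComplete C] {X : C} {I : Type*} [Fintype I]
    {e : I → End X} (he : OrthogonalIdempotents e) (h0 : ∀ k, e k ≠ 0) :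
    (Fintype.card I : ℕ∞) ≤ objectLength X := by
  choose A i r hir hri using fun T : Finset I =>
    IsIdempotentComplete.idempotents_split X (∑ k ∈ T, e k) he.isIdempotentElem_sum
  let R T : Retract (A T) X := ⟨i T, r T, hir T⟩
  have hR : ∀ T, Mono (R T).i := fun T => (R T).splitMono.mono
  have hlt : StrictMono fun T => Subobject.mk (R T).i := strictMono_of_le_iff_le fun T U => by
    rw [mk_le_mk_iff_of_retract, show (R T).r ≫ (R T).i = _ from hri T,
      show (R U).r ≫ (R U).i = _ from hri U, ← sum_mul_sum_eq_iff_subset he h0, End.mul_def]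
  calc (Fintype.card I : ℕ∞) ≤ Order.height (Finset.univ : Finset I) := card_le_height _
    _ ≤ Order.height (Subobject.mk (R Finset.univ).i) :=
        Order.height_le_height_apply_of_strictMono _ hlt _
    _ ≤ objectLength X := Order.height_mono le_top

/-- The object `M` is a direct summand of a finite power of `T`, expressed without assuming that
powers exist. -/
def IsSummandOfPower (M T : C) : Prop :=
  ∃ (J : Type) (_ : Fintype J) (i : J → (M ⟶ T)) (p : J → (T ⟶ M)), ∑ j, i j ≫ p j = 𝟙 M

lemma IsSummandOfPower.exists_factor {A M N T : C} (h : IsSummandOfPower A T) {f : A ⟶ M}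
    {g : N ⟶ M} (hfg : ∀ t : T ⟶ A, ∃ s : T ⟶ N, s ≫ g = t ≫ f) : ∃ s : A ⟶ N, s ≫ g = f := by
  obtain ⟨J, _, i, p, hip⟩ := h
  choose s hs using hfg
  refine ⟨∑ j, i j ≫ s (p j), ?_⟩
  simp only [Preadditive.sum_comp, Category.assoc, hs]
  simp only [← Category.assoc, ← Preadditive.sum_comp, hip, Category.id_comp]

/-- A subobject `N` of `M` is recovered from the space of morphisms `T ⟶ M` that factor through
it. -/
lemma objectLength_le_finrank (k : Type*) [Field k] [Linear k C] {M T : C}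
    [FiniteDimensional k (T ⟶ M)] (h : ∀ N : Subobject M, IsSummandOfPower (N : C) T) :
    objectLength M ≤ Module.finrank k (T ⟶ M) := by
  let V : Subobject M → Submodule k (T ⟶ M) := fun N =>
    LinearMap.range (Linear.rightComp k T N.arrow)
  have hV : StrictMono V := strictMono_of_le_iff_le fun N N' => by
    refine ⟨fun hle => ?_, fun hle => ?_⟩
    · rintro _ ⟨t, rfl⟩
      exact ⟨t ≫ Subobject.ofLE N N' hle, by simp⟩
    · obtain ⟨s, hs⟩ := (h N).exists_factor (f := N.arrow) (g := N'.arrow) fun t => hle ⟨t, rfl⟩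
      exact Subobject.le_of_comm s hs
  calc objectLength M ≤ Order.height (V ⊤) := Order.height_le_height_apply_of_strictMono V hV ⊤
    _ ≤ Order.height (⊤ : Submodule k (T ⟶ M)) := Order.height_mono le_top
    _ = Module.finrank k (T ⟶ M) := by rw [← Module.length_eq_height, Module.length_eq_finrank]

end Length

section EssImage

variable {D E : Type*} [Category* D] [Category* E] {G : D ⥤ E} [G.Full] [G.Faithful]
  [IsIdempotentComplete D]

lemma essImage_of_retract {M : E} {X : D} (h : Retract M (G.obj X)) : G.essImage M := by
  obtain ⟨A, i, r, hir, hri⟩ := IsIdempotentComplete.idempotents_split X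
    (G.preimage (h.r ≫ h.i)) (G.map_injective (by simp))
  have hri : G.map r ≫ G.map i = h.r ≫ h.i := by rw [← G.map_comp, hri, G.map_preimage]
  have hir : G.map i ≫ G.map r = 𝟙 _ := by rw [← G.map_comp, hir, G.map_id]
  refine ⟨A, ⟨G.map i ≫ h.r, h.i ≫ G.map r, ?_, ?_⟩⟩
  · rw [Category.assoc, ← Category.assoc h.r, ← hri, Category.assoc, reassoc_of% hir, hir]
  · rw [Category.assoc, reassoc_of% hri, h.retract, h.retract_assoc]

lemma IsSummandOfPower.essImage [Preadditive D] [Preadditive E] [G.Additive]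
    [HasFiniteBiproducts D] {M : E} {R : D} (h : IsSummandOfPower M (G.obj R)) :
    G.essImage M := by
  classical
  obtain ⟨J, _, i, p, hip⟩ := h
  refine essImage_of_retract (X := ⨁ fun _ : J => R)
    ⟨∑ j, i j ≫ G.map (biproduct.ι (fun _ => R) j), ∑ j, G.map (biproduct.π (fun _ => R) j) ≫ p j,
      ?_⟩
  have hιπ : ∀ j k, G.map (biproduct.ι (fun _ : J => R) j) ≫ G.map (biproduct.π _ k) ≫ p k =
      if j = k then p k else 0 := fun j k => by
    rw [← Category.assoc, ← G.map_comp, biproduct.ι_π]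
    split_ifs <;> simp
  simp only [Preadditive.sum_comp, Preadditive.comp_sum, Category.assoc, hιπ]
  simpa [comp_ite] using hip

end EssImage

/-! ### Functors to inverse limits of categories -/

section InvLimHom

universe v u

variable {C : ℕ → Type u} [∀ n, Category.{v} (C n)] {F : ∀ n, C (n + 1) ⥤ C n} {X Y : InvLim C F}

lemma InvLim.hom_app_eq (f : X ⟶ Y) (n : ℕ) :
    f.app n = (X.iso n).inv ≫ (F n).map (f.app (n + 1)) ≫ (Y.iso n).hom := by
  rw [f.comm, Iso.inv_hom_id_assoc]

lemma InvLim.hom_ext_of_le {f g : X ⟶ Y} (N : ℕ) (h : ∀ n, N ≤ n → f.app n = g.app n) : f = g := by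
  induction N with
  | zero => exact InvLim.hom_ext fun n => h n n.zero_le
  | succ N ih =>
    refine ih fun n hn => ?_
    rcases hn.eq_or_lt with rfl | hn
    · rw [InvLim.hom_app_eq f, InvLim.hom_app_eq g, h _ le_rfl]
    · exact h n hn

lemma InvLim.isIso_of_app (f : X ⟶ Y) (h : ∀ n, IsIso (f.app n)) : IsIso f := by
  refine ⟨⟨⟨fun n => inv (f.app n), fun n => ?_⟩, InvLim.hom_ext fun n => IsIso.hom_inv_id _,
    InvLim.hom_ext fun n => IsIso.inv_hom_id _⟩⟩
  rw [Functor.map_inv, IsIso.inv_comp_eq, ← Category.assoc, f.comm, Category.assoc,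
    IsIso.hom_inv_id, Category.comp_id]

lemma InvLim.nonempty_iso_of_le (N : ℕ) (φ : ∀ n, N ≤ n → (X.obj n ≅ Y.obj n))
    (hφ : ∀ n hn, (F n).map (φ (n + 1) (hn.trans n.le_succ)).hom ≫ (Y.iso n).hom =
      (X.iso n).hom ≫ (φ n hn).hom) : Nonempty (X ≅ Y) := by
  induction N with
  | zero =>
    let f : X ⟶ Y := ⟨fun n => (φ n n.zero_le).hom, fun n => hφ n n.zero_le⟩
    have : IsIso f := InvLim.isIso_of_app f fun n => inferInstanceAs (IsIso (φ n n.zero_le).hom)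
    exact ⟨asIso f⟩
  | succ N ih =>
    let ψ : X.obj N ≅ Y.obj N := (X.iso N).symm ≪≫ (F N).mapIso (φ (N + 1) le_rfl) ≪≫ Y.iso N
    refine ih (fun n hn => if h : N + 1 ≤ n then φ n h else
      have hN : N = n := by omega
      hN ▸ ψ) fun n hn => ?_
    rcases hn.eq_or_lt with rfl | hn
    · rw [dif_pos le_rfl, dif_neg (by omega)]
      simp [ψ]
    · rw [dif_pos (show N + 1 ≤ n + 1 by omega), dif_pos (show N + 1 ≤ n by omega)]
      exact hφ n hn

variable {D : Type*} [Category* D] (G : ∀ n, D ⥤ C n) (α : ∀ n, G (n + 1) ⋙ F n ≅ G n)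

lemma InvLim.map_eq_lift_map {X Y : D} (φ : (InvLim.lift G α).obj X ⟶ (InvLim.lift G α).obj Y)
    {n : ℕ} {f : X ⟶ Y} (hf : (G (n + 1)).map f = φ.app (n + 1)) : (G n).map f = φ.app n := by
  refine (cancel_epi ((α n).hom.app X)).1 (((α n).hom.naturality f).symm.trans ?_)
  exact (congrArg (fun ψ => (F n).map ψ ≫ (α n).hom.app Y) hf).trans (φ.comm n)

lemma InvLim.lift_full (N : ℕ) (hfull : ∀ n, N ≤ n → (G n).Full)
    (hfaithful : ∀ n, N ≤ n → (G n).Faithful) : (InvLim.lift G α).Full where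
  map_surjective {X Y} φ := by
    have h : ∀ n, N ≤ n → ∃ f : X ⟶ Y, (G n).map f = φ.app n := fun n hn =>
      have := hfull n hn
      (G n).map_surjective _
    obtain ⟨f, hf⟩ := h N le_rfl
    refine ⟨f, InvLim.hom_ext_of_le N fun n hn => ?_⟩
    induction n, hn using Nat.le_induction with
    | base => exact hf
    | succ n hn ih =>
      obtain ⟨g, hg⟩ := h (n + 1) (hn.trans n.le_succ)
      have := hfaithful n hn
      obtain rfl : g = f := (G n).map_injective ((InvLim.map_eq_lift_map G α φ hg).trans ih.symm)
      exact hg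

/-- The object `M_{n+1}` is `G_{n+1}(X')` for some `X'`, and `X' ≅ X` since `G_n` is fully
faithful. -/
lemma InvLim.exists_lift_iso {M : InvLim C F} {X : D} {n : ℕ} [(G n).Full] [(G n).Faithful]
    (hM : (G (n + 1)).essImage (M.obj (n + 1))) (φ : (G n).obj X ≅ M.obj n) :
    ∃ ψ : (G (n + 1)).obj X ≅ M.obj (n + 1),
      (F n).map ψ.hom ≫ (M.iso n).hom = (α n).hom.app X ≫ φ.hom := by
  obtain ⟨X', ⟨b⟩⟩ := hM
  let χ : (G n).obj X ≅ (G n).obj X' :=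
    φ ≪≫ (M.iso n).symm ≪≫ (F n).mapIso b.symm ≪≫ (α n).app X'
  refine ⟨(G (n + 1)).mapIso ((G n).preimageIso χ) ≪≫ b, ?_⟩
  have hnat : (F n).map ((G (n + 1)).map ((G n).preimage χ.hom)) =
      (α n).hom.app X ≫ χ.hom ≫ (α n).inv.app X' := by
    simpa using (NatIso.naturality_2 (α n) ((G n).preimage χ.hom)).symm
  simp only [Iso.trans_hom, Functor.mapIso_hom, Functor.preimageIso_hom, Functor.map_comp, hnat]
  simp [χ]

lemma InvLim.essImage_lift {M : InvLim C F} (N : ℕ) (hfull : ∀ n, N ≤ n → (G n).Full)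
    (hfaithful : ∀ n, N ≤ n → (G n).Faithful) (hM : ∀ n, N ≤ n → (G n).essImage (M.obj n)) :
    (InvLim.lift G α).essImage M := by
  obtain ⟨X, ⟨φ₀⟩⟩ := hM N le_rfl
  have hext : ∀ n, N ≤ n → ∀ φ : (G n).obj X ≅ M.obj n, ∃ ψ : (G (n + 1)).obj X ≅ M.obj (n + 1),
      (F n).map ψ.hom ≫ (M.iso n).hom = (α n).hom.app X ≫ φ.hom := fun n hn φ =>
    have := hfull n hn
    have := hfaithful n hn
    InvLim.exists_lift_iso G α (hM (n + 1) (hn.trans n.le_succ)) φ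
  choose ψ hψ using hext
  let φ : ∀ n, N ≤ n → ((G n).obj X ≅ M.obj n) := fun n hn =>
    Nat.leRec (motive := fun n _ => (G n).obj X ≅ M.obj n) φ₀ (fun n hn φ => ψ n hn φ) hn
  refine ⟨X, InvLim.nonempty_iso_of_le N φ fun n hn => ?_⟩
  have h : φ (n + 1) (hn.trans n.le_succ) = ψ n hn (φ n hn) := Nat.leRec_succ _ _ hn
  rw [h]
  exact hψ n hn (φ n hn)

end InvLimHom

/-! ### Homomorphisms out of tensor powers -/

section TensorHom

variable {d d' : ℕ} {ι : Type}

/-- The basis vector `e_{w_1} ⊗ ⋯ ⊗ e_{w_d}` of `(ℂ^N)^{⊗ d}`. -/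
def tvec (w : Fin d → ι) : TPow ι d := PiTensorProduct.tprod ℂ fun k => Finsupp.single (w k) 1

/-- The basis of `(ℂ^N)^{⊗ d}` given by the tensors of standard basis vectors. -/
def tbasis (ι : Type) (d : ℕ) : Module.Basis (Fin d → ι) ℂ (TPow ι d) :=
  letI := Classical.decEq ι
  Basis.piTensorProduct fun _ : Fin d => (Finsupp.basisSingleOne : Module.Basis ι ℂ (ι →₀ ℂ))

lemma tbasis_apply (w : Fin d → ι) : tbasis ι d w = tvec w := by
  classical
  simp [tbasis, Basis.piTensorProduct_apply, tvec]

lemma tbasis_repr_tvec [DecidableEq (Fin d → ι)] (u w : Fin d → ι) :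
    (tbasis ι d).repr (tvec u) w = if u = w then 1 else 0 := by
  rw [← tbasis_apply, Module.Basis.repr_self, Finsupp.single_apply]

lemma lieModuleHom_ext_tvec {M : Type*} [AddCommGroup M] [Module ℂ M] [LieRingModule (gl ι) M]
    {φ ψ : TPow ι d →ₗ⁅ℂ,gl ι⁆ M} (h : ∀ w, φ (tvec w) = ψ (tvec w)) : φ = ψ :=
  LieModuleHom.ext <| LinearMap.congr_fun <|
    (tbasis ι d).ext (f₁ := φ.toLinearMap) (f₂ := ψ.toLinearMap) fun w => by
      rw [tbasis_apply]
      exact h w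

section Weights

/-- The weight of the basis vector `e_{w_1} ⊗ ⋯ ⊗ e_{w_d}` for the diagonal matrices, encoded as the
multiset of the `w_k`: the diagonal matrix unit of index `a` acts by the multiplicity of `a`. -/
def weight (w : Fin d → ι) : Multiset ι := Finset.univ.val.map w

lemma card_weight (w : Fin d → ι) : (weight w).card = d := by
  simp [weight]

lemma diagUnit_lie_tvec [DecidableEq ι] (a : ι) (w : Fin d → ι) :
    ⁅diagUnit a, tvec w⁆ = ((weight w).count a : ℂ) • tvec w := by
  rw [lie_tpow, tvec, tensorDeriv_tprod, weight, Multiset.count_map, ← Finset.filter_val,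
    Finset.card_val, Finset.card_filter, Nat.cast_sum, Finset.sum_smul]
  refine Finset.sum_congr rfl fun k _ => ?_
  rw [diagUnit_single]
  by_cases h : w k = a
  · rw [if_pos h, if_pos h.symm,
      Function.update_eq_self (f := fun k => Finsupp.single (w k) (1 : ℂ)), Nat.cast_one, one_smul]
  · rw [if_neg h, if_neg (Ne.symm h), MultilinearMap.map_update_zero, Nat.cast_zero, zero_smul]

lemma tbasis_repr_diagUnit_lie [DecidableEq ι] (a : ι) (w : Fin d → ι) (t : TPow ι d) :
    (tbasis ι d).repr ⁅diagUnit a, t⁆ w = (weight w).count a * (tbasis ι d).repr t w := by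
  classical
  suffices (tbasis ι d).coord w ∘ₗ LieModule.toEnd ℂ (gl ι) (TPow ι d) (diagUnit a) =
      ((weight w).count a : ℂ) • (tbasis ι d).coord w from LinearMap.congr_fun this t
  refine (tbasis ι d).ext fun u => ?_
  rw [LinearMap.comp_apply, LieModule.toEnd_apply_apply, tbasis_apply, diagUnit_lie_tvec, map_smul,
    LinearMap.smul_apply, Module.Basis.coord_apply, tbasis_repr_tvec]
  split_ifs with h
  · rw [h]
  · simp

lemma weight_eq_of_repr_ne_zero {ψ : TPow ι d →ₗ⁅ℂ,gl ι⁆ TPow ι d'} {u : Fin d → ι}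
    {v : Fin d' → ι} (h : (tbasis ι d').repr (ψ (tvec u)) v ≠ 0) : weight v = weight u := by
  classical
  refine Multiset.ext.2 fun a => ?_
  have h1 := tbasis_repr_diagUnit_lie a v (ψ (tvec u))
  rw [← LieModuleHom.map_lie, diagUnit_lie_tvec, map_smul, map_smul, Finsupp.smul_apply,
    smul_eq_mul] at h1
  exact_mod_cast (mul_right_cancel₀ h h1).symm

lemma tensorHom_eq_zero (hd : d' ≠ d) (ψ : TPow ι d →ₗ⁅ℂ,gl ι⁆ TPow ι d') : ψ = 0 :=
  lieModuleHom_ext_tvec fun u => (tbasis ι d').ext_elem fun v => by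
    by_contra h
    rw [LieModuleHom.zero_apply, map_zero, Finsupp.zero_apply] at h
    refine hd ?_
    rw [← card_weight v, weight_eq_of_repr_ne_zero h, card_weight]

end Weights

section Generation

/-- The matrix unit `E_{ab}`. -/
def matUnit (a b : ι) : gl ι :=
  ⟨Finsupp.lsingle a ∘ₗ Finsupp.lapply b, (Set.finite_singleton (a, b)).subset fun p hp => by
    classical
    have hp : Finsupp.single a (Finsupp.single p.2 (1 : ℂ) b) p.1 ≠ 0 := hp
    rw [Finsupp.single_apply, Finsupp.single_apply] at hp
    simp only [ne_eq, ite_eq_right_iff, one_ne_zero, imp_false, not_forall, not_not] at hp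
    exact Prod.ext hp.1.symm hp.2⟩

lemma matUnit_single (a b i : ι) [Decidable (i = b)] :
    (matUnit a b).1 (Finsupp.single i 1) = if i = b then Finsupp.single a 1 else 0 := by
  change Finsupp.single a (Finsupp.single i (1 : ℂ) b) = _
  split_ifs with h
  · rw [h, Finsupp.single_eq_same]
  · rw [Finsupp.single_eq_of_ne (Ne.symm h), Finsupp.single_zero]

lemma matUnit_lie_tvec (w : Fin d → ι) (k : Fin d) (a : ι) (hw : ∀ l, l ≠ k → w l ≠ w k) :
    ⁅matUnit a (w k), tvec w⁆ = tvec (Function.update w k a) := by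
  classical
  rw [lie_tpow, tvec, tensorDeriv_tprod, Finset.sum_eq_single k]
  · rw [matUnit_single, if_pos rfl, tvec]
    congr 1
    funext j
    by_cases hj : j = k
    · subst hj; simp
    · simp [hj]
  · intro l _ hl
    rw [matUnit_single, if_neg (hw l hl), MultilinearMap.map_update_zero]
  · simp

variable {M : Type*} [AddCommGroup M] [Module ℂ M] [LieRingModule (gl ι) M]
  {φ ψ : TPow ι d →ₗ⁅ℂ,gl ι⁆ M}

/-- Matrix units replace the entries of `u` by those of `v` one at a time. -/
lemma apply_tvec_eq_of_disjoint {u v : Fin d → ι} (hu : Function.Injective u)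
    (huv : ∀ k l, u k ≠ v l) (h : φ (tvec u) = ψ (tvec u)) : φ (tvec v) = ψ (tvec v) := by
  classical
  have key : ∀ s : Finset (Fin d), φ (tvec (s.piecewise v u)) = ψ (tvec (s.piecewise v u)) :=
    fun s => by
      induction s using Finset.induction_on with
      | empty => simpa using h
      | insert k s hk ih =>
        rw [Finset.piecewise_insert, ← matUnit_lie_tvec, LieModuleHom.map_lie, ih,
          LieModuleHom.map_lie]
        intro l hl
        rw [Finset.piecewise_eq_of_notMem _ _ _ hk]
        by_cases hls : l ∈ s
        · rw [Finset.piecewise_eq_of_mem _ _ _ hls]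
          exact (huv k l).symm
        · rw [Finset.piecewise_eq_of_notMem _ _ _ hls]
          exact hu.ne hl
  simpa using key Finset.univ

/-- The space `ℂ^N` is large with respect to the degree `d`, that is, `N ≥ 3d`: two families of `d`
basis vectors are avoided by a third family of distinct basis vectors. -/
def IsLarge (ι : Type) (d : ℕ) : Prop := Nonempty (Fin (3 * d) ↪ ι)

lemma IsLarge.mono (h : IsLarge ι d) (hd : d' ≤ d) : IsLarge ι d' :=
  ⟨(Fin.castLEEmb (by omega)).trans h.some⟩

lemma isLarge_nat (d : ℕ) : IsLarge ℕ d := ⟨Fin.valEmbedding⟩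

lemma isLarge_fin {n d : ℕ} (h : 3 * d ≤ n) : IsLarge (Fin n) d := ⟨Fin.castLEEmb h⟩

lemma IsLarge.exists_injective (h : IsLarge ι d) : ∃ w : Fin d → ι, Function.Injective w :=
  ⟨h.some ∘ Fin.castLE (by omega), h.some.injective.comp (Fin.castLE_injective _)⟩

lemma IsLarge.exists_disjoint (h : IsLarge ι d) (u v : Fin d → ι) :
    ∃ w : Fin d → ι, Function.Injective w ∧ (∀ k l, w k ≠ u l) ∧ ∀ k l, w k ≠ v l := by
  classical
  let s : Finset ι := Finset.univ.image u ∪ Finset.univ.image v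
  let T : Finset ι := Finset.univ.map h.some
  have hs : s.card ≤ d + d := (Finset.card_union_le _ _).trans <| add_le_add
    (Finset.card_image_le.trans (by simp)) (Finset.card_image_le.trans (by simp))
  have hT : T.card = 3 * d := by simp [T]
  have hcard : d ≤ (T \ s).card := by
    have := Finset.le_card_sdiff s T
    omega
  let w : Fin d → ι := fun k => (T \ s).equivFin.symm (Fin.castLE hcard k)
  have hw : ∀ k, w k ∉ s := fun k => (Finset.mem_sdiff.1 (Subtype.prop _)).2
  refine ⟨w, ?_, fun k l h => hw k ?_, fun k l h => hw k ?_⟩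
  · exact Subtype.val_injective.comp ((Equiv.injective _).comp (Fin.castLE_injective hcard))
  · exact Finset.mem_union_left _ (Finset.mem_image.2 ⟨l, Finset.mem_univ l, h.symm⟩)
  · exact Finset.mem_union_right _ (Finset.mem_image.2 ⟨l, Finset.mem_univ l, h.symm⟩)

lemma lieModuleHom_ext_of_injective (hι : IsLarge ι d) {w : Fin d → ι} (hw : Function.Injective w)
    (h : φ (tvec w) = ψ (tvec w)) : φ = ψ :=
  lieModuleHom_ext_tvec fun u => by
    obtain ⟨v, hv, hvw, hvu⟩ := hι.exists_disjoint w u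
    exact apply_tvec_eq_of_disjoint hv hvu
      (apply_tvec_eq_of_disjoint hw (fun k l => (hvw l k).symm) h)

end Generation

section Endomorphisms

lemma permTPow_tvec (σ : Equiv.Perm (Fin d)) (w : Fin d → ι) :
    permTPow ι d σ (tvec w) = tvec (w ∘ ⇑σ⁻¹) :=
  permTPow_tprod σ _

/-- The action of a permutation on `(ℂ^N)^{⊗ d}`, as a homomorphism of `𝔤𝔩_N`-modules. -/
def permHom (ι : Type) (σ : Equiv.Perm (Fin d)) : TPow ι d →ₗ⁅ℂ,gl ι⁆ TPow ι d :=
  { permTPow ι d σ with map_lie' := fun {A t} => (permTPow_tensorDeriv σ A.1 t).symm }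

lemma permHom_tvec (σ : Equiv.Perm (Fin d)) (w : Fin d → ι) :
    permHom ι σ (tvec w) = tvec (w ∘ ⇑σ⁻¹) :=
  permTPow_tvec σ w

lemma exists_perm_of_weight_eq {v w : Fin d → ι} (hw : Function.Injective w)
    (h : weight v = weight w) : ∃ σ : Equiv.Perm (Fin d), v = w ∘ ⇑σ⁻¹ := by
  have hmem : ∀ k, ∃ l, v l = w k := fun k => by
    have hk : w k ∈ weight v := h ▸ Multiset.mem_map_of_mem w (Finset.mem_univ k)
    obtain ⟨l, -, hl⟩ := Multiset.mem_map.1 hk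
    exact ⟨l, hl⟩
  choose τ hτ using hmem
  have hτ_inj : Function.Injective τ := fun k l hkl => hw (by rw [← hτ k, ← hτ l, hkl])
  let σ : Equiv.Perm (Fin d) := Equiv.ofBijective τ (Finite.injective_iff_bijective.1 hτ_inj)
  refine ⟨σ, funext fun k => ?_⟩
  rw [Function.comp_apply, ← hτ]
  exact congrArg v (σ.apply_symm_apply k).symm

lemma hom_tvec_eq_sum (ψ : TPow ι d →ₗ⁅ℂ,gl ι⁆ TPow ι d) {w : Fin d → ι}
    (hw : Function.Injective w) :
    ψ (tvec w) = ∑ σ : Equiv.Perm (Fin d),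
      (tbasis ι d).repr (ψ (tvec w)) (w ∘ ⇑σ⁻¹) • permHom ι σ (tvec w) := by
  classical
  have hinj : ∀ σ τ : Equiv.Perm (Fin d), w ∘ ⇑σ⁻¹ = w ∘ ⇑τ⁻¹ → σ = τ := fun σ τ h =>
    inv_injective (Equiv.ext fun k => hw (congrFun h k))
  refine (tbasis ι d).ext_elem fun v => ?_
  simp only [map_sum, Finsupp.finsetSum_apply, map_smul, Finsupp.smul_apply, permHom_tvec,
    tbasis_repr_tvec, smul_eq_mul]
  by_cases hv : ∃ σ : Equiv.Perm (Fin d), v = w ∘ ⇑σ⁻¹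
  · obtain ⟨σ, rfl⟩ := hv
    rw [Finset.sum_eq_single σ]
    · simp
    · intro τ _ hτ
      rw [if_neg fun h => hτ (hinj _ _ h), mul_zero]
    · simp
  · rw [Finset.sum_eq_zero fun τ _ => by rw [if_neg fun h => hv ⟨τ, h.symm⟩, mul_zero]]
    by_contra h
    exact hv (exists_perm_of_weight_eq hw (weight_eq_of_repr_ne_zero h))

theorem exists_forall_apply_eq_sum_permTPow (hι : IsLarge ι d)
    (ψ : TPow ι d →ₗ⁅ℂ,gl ι⁆ TPow ι d) :
    ∃ c : Equiv.Perm (Fin d) → ℂ, ∀ t, ψ t = ∑ σ, c σ • permTPow ι d σ t := by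
  obtain ⟨w, hw⟩ := hι.exists_injective
  let c : Equiv.Perm (Fin d) → ℂ := fun σ => (tbasis ι d).repr (ψ (tvec w)) (w ∘ ⇑σ⁻¹)
  suffices ψ = ∑ σ, c σ • permHom ι σ from
    ⟨c, fun t => (LieModuleHom.congr_fun this t).trans (lieModuleHom_sum_apply _ _ t)⟩
  refine lieModuleHom_ext_of_injective hι hw ?_
  rw [lieModuleHom_sum_apply]
  exact hom_tvec_eq_sum ψ hw

end Endomorphisms

end TensorHom

/-! ### The Schur–Weyl functors in bounded degrees -/

section SWSpace

variable {d d' : ℕ} {ι : Type} {X Y : RepSym d}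

lemma repSym_hom_ext {f g : X ⟶ Y} (h : ∀ x, toIntertwining f x = toIntertwining g x) : f = g := by
  ext x
  exact h x

/-- The morphism of representations with a given underlying equivariant linear map. -/
def repSymHomMk (g : X →ₗ[ℂ] Y) (hg : ∀ σ x, g (X.ρ σ x) = Y.ρ σ (g x)) : X ⟶ Y :=
  ⟨InducedCategory.homMk (ModuleCat.ofHom g), fun σ => by
    ext x
    exact hg σ x⟩

lemma swSpace_ext {f g : SWSpace ι X} (h : ∀ x, f x = g x) : f = g :=
  Representation.IntertwiningMap.ext (LinearMap.ext h)

lemma swSpace_apply_ρ (f : SWSpace ι X) (σ : Equiv.Perm (Fin d)) (x : X) :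
    f (X.ρ σ x) = permTPow ι d σ (f x) :=
  Representation.IntertwiningMap.isIntertwining _ _ f σ x

lemma averageForm_apply (l : X →ₗ[ℂ] ℂ) (t : TPow ι d) (x : X) :
    averageForm X l t x = (Fintype.card (Equiv.Perm (Fin d)) : ℂ)⁻¹ •
      ∑ σ : Equiv.Perm (Fin d), l (X.ρ σ⁻¹ x) • permTPow ι d σ t := by
  refine (average_apply X _ x).trans (congrArg _ (Finset.sum_congr rfl fun σ _ => ?_))
  exact map_smul (permTPow ι d σ) (l (X.ρ σ⁻¹ x)) t

lemma repr_averageForm_tvec {w : Fin d → ι} (hw : Function.Injective w) (l : X →ₗ[ℂ] ℂ) (x : X) :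
    (tbasis ι d).repr (averageForm X l (tvec w) x) w =
      (Fintype.card (Equiv.Perm (Fin d)) : ℂ)⁻¹ * l x := by
  classical
  rw [averageForm_apply, map_smul, Finsupp.smul_apply, smul_eq_mul, map_sum,
    Finsupp.finsetSum_apply, Finset.sum_eq_single 1]
  · simp [tbasis_repr_tvec]
  · intro σ _ hσ
    have hne : w ∘ ⇑σ⁻¹ ≠ w := fun h =>
      hσ (inv_eq_one.1 (Equiv.ext fun k => hw (congrFun h k)))
    rw [permTPow_tvec, map_smul, Finsupp.smul_apply, tbasis_repr_tvec, if_neg hne, smul_zero]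
  · simp

lemma swSpace_separates {w : Fin d → ι} (hw : Function.Injective w) {x y : X}
    (h : ∀ f : SWSpace ι X, f x = f y) : x = y := by
  refine sub_eq_zero.1 ((Module.forall_dual_apply_eq_zero_iff ℂ _).1 fun l => ?_)
  rw [map_sub, sub_eq_zero]
  have hc : (Fintype.card (Equiv.Perm (Fin d)) : ℂ)⁻¹ ≠ 0 :=
    inv_ne_zero (Nat.cast_ne_zero.2 Fintype.card_ne_zero)
  refine mul_left_cancel₀ hc ?_
  rw [← repr_averageForm_tvec hw, h, repr_averageForm_tvec hw]

lemma swHom_apply_eq_sum {X' : RepSym d'} (φ : SWSpace ι Y →ₗ⁅ℂ,gl ι⁆ SWSpace ι X')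
    (f : SWSpace ι Y) (x : X') :
    φ f x = ∑ k, ((evalAt X' x).comp φ).comp (averageForm Y ((Module.finBasis ℂ Y).coord k))
      (f (Module.finBasis ℂ Y k)) := by
  conv_lhs => rw [← sum_averageForm Y f]
  exact map_sum ((evalAt X' x).comp φ) _ _

lemma swHom_eq_zero (hd : d' ≠ d) {X' : RepSym d'} (φ : SWSpace ι Y →ₗ⁅ℂ,gl ι⁆ SWSpace ι X') :
    φ = 0 :=
  LieModuleHom.ext fun f => swSpace_ext fun x => by
    rw [swHom_apply_eq_sum]
    refine Finset.sum_eq_zero fun k _ => ?_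
    exact LieModuleHom.congr_fun (tensorHom_eq_zero hd _) _

lemma exists_forall_swHom_apply_eq (hι : IsLarge ι d) (φ : SWSpace ι Y →ₗ⁅ℂ,gl ι⁆ SWSpace ι X)
    (x : X) : ∃ y : Y, ∀ f, φ f x = f y := by
  choose c hc using fun k => exists_forall_apply_eq_sum_permTPow hι
    (((evalAt X x).comp φ).comp (averageForm Y ((Module.finBasis ℂ Y).coord k)))
  refine ⟨∑ k, ∑ σ, c k σ • Y.ρ σ (Module.finBasis ℂ Y k), fun f => ?_⟩
  rw [swHom_apply_eq_sum, map_sum]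
  refine Finset.sum_congr rfl fun k _ => ?_
  refine (hc k _).trans ?_
  rw [map_sum]
  refine Finset.sum_congr rfl fun σ _ => ?_
  rw [map_smul, swSpace_apply_ρ]
  rfl

theorem exists_hom_of_swHom (hι : IsLarge ι d) (φ : SWSpace ι Y →ₗ⁅ℂ,gl ι⁆ SWSpace ι X) :
    ∃ g : X ⟶ Y, ∀ f x, φ f x = f (toIntertwining g x) := by
  obtain ⟨w, hw⟩ := hι.exists_injective
  choose g hg using exists_forall_swHom_apply_eq hι φ
  let g' : X →ₗ[ℂ] Y :=
    { toFun := g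
      map_add' := fun x y => swSpace_separates hw fun f => by
        rw [← hg, map_add, map_add, hg, hg]
      map_smul' := fun c x => swSpace_separates hw fun f => by
        rw [← hg, map_smul, map_smul, hg, RingHom.id_apply] }
  refine ⟨repSymHomMk g' fun σ x => swSpace_separates hw fun f => ?_, fun f x => hg x f⟩
  change f (g (X.ρ σ x)) = f (Y.ρ σ (g x))
  rw [← hg, swSpace_apply_ρ, swSpace_apply_ρ, hg]

end SWSpace

section DegreeLE

variable {D : ℕ} {ι : Type}

/-- The families of representations which vanish in degrees greater than `D`. -/
def DegreeLE (D : ℕ) : ObjectProperty SumRepSym := fun X => ∀ d, D < d → IsZero (X.obj d)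

lemma DegreeLE.mono {D' : ℕ} (h : D ≤ D') : DegreeLE D ≤ DegreeLE D' :=
  fun _ hX d hd => hX d (h.trans_lt hd)

lemma exists_degreeLE (X : SumRepSym) : ∃ D, DegreeLE D X := by
  obtain ⟨D, hD⟩ := X.property.bddAbove
  exact ⟨D, fun d hd => by_contra fun h => hd.not_ge (hD h)⟩

instance : (DegreeLE D).IsStableUnderRetracts where
  of_retract h hY d hd := (IsZero.iff_id_eq_zero _).2 <|
    calc 𝟙 _ = h.i.hom d ≫ h.r.hom d := congrArg (fun f => f.hom d) h.retract.symm
      _ = 0 := by rw [(hY d hd).eq_of_tgt (h.i.hom d) 0, zero_comp]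

instance : (DegreeLE D).IsClosedUnderFiniteProducts where
  isClosedUnderLimitsOfShape _ _ := ⟨by
    rintro X ⟨p⟩ d hd
    exact isZero_pi_apply_of_isLimit (isLimitOfPreserves FinitelySupported.ι p.isLimit)
      fun j => p.prop_diag_obj j d hd⟩

/-- The Schur–Weyl functor on families of representations in degrees at most `D`. -/
abbrev swLE (D : ℕ) (ι : Type) : (DegreeLE D).FullSubcategoryᵒᵖ ⥤ RepPoly ι :=
  (DegreeLE D).ι.op ⋙ SW ι

/-- The homomorphism of `𝔤𝔩_N`-modules underlying a morphism of `Rep(𝔤𝔩_N)_poly`. -/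
def polyHom {M N : RepPoly ι} (f : M ⟶ N) : M.obj.carrier →ₗ⁅ℂ,gl ι⁆ N.obj.carrier := f.hom

lemma repPoly_hom_ext {M N : RepPoly ι} {f g : M ⟶ N} (h : ∀ m, polyHom f m = polyHom g m) :
    f = g :=
  ObjectProperty.hom_ext _ (LieModuleHom.ext h)

/-- The inclusion `Hom_{S_d}(X_d, (ℂ^N)^{⊗ d}) → SW_N(X)`. -/
def swOf (ι : Type) (X : SumRepSym) (d : ℕ) :
    SWSpace ι (X.obj d) →ₗ⁅ℂ,gl ι⁆ ((SW ι).obj (Opposite.op X)).obj.carrier :=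
  DirectSum.lieModuleOf ℂ ℕ (gl ι)
    (fun d => ((swDegree ι d).obj (Opposite.op (X.obj d))).carrier) d

/-- The projection `SW_N(X) → Hom_{S_d}(X_d, (ℂ^N)^{⊗ d})`. -/
def swComponent (ι : Type) (X : SumRepSym) (d : ℕ) :
    ((SW ι).obj (Opposite.op X)).obj.carrier →ₗ⁅ℂ,gl ι⁆ SWSpace ι (X.obj d) :=
  DirectSum.lieModuleComponent ℂ ℕ (gl ι)
    (fun d => ((swDegree ι d).obj (Opposite.op (X.obj d))).carrier) d

lemma swComponent_swOf (X : SumRepSym) (d : ℕ) (f : SWSpace ι (X.obj d)) :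
    swComponent ι X d (swOf ι X d f) = f :=
  DirectSum.component.lof_self ℂ
    (M := fun d => ((swDegree ι d).obj (Opposite.op (X.obj d))).carrier) d f

lemma swComponent_map_swOf {X Y : SumRepSym} (g : X ⟶ Y) {d : ℕ} (f : SWSpace ι (Y.obj d))
    (x : X.obj d) :
    swComponent ι X d (polyHom ((SW ι).map g.op) (swOf ι Y d f)) x =
      f (toIntertwining (g.hom d) x) :=
  congrArg (fun f' : SWSpace ι (Y.obj d) => f' (toIntertwining (g.hom d) x))
    (swComponent_swOf Y d f)

lemma sw_ext {X : SumRepSym} {m m' : ((SW ι).obj (Opposite.op X)).obj.carrier}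
    (h : ∀ d, swComponent ι X d m = swComponent ι X d m') : m = m' :=
  DFinsupp.ext h

lemma sw_hom_ext {X : SumRepSym} {M : RepPoly ι} {φ ψ : (SW ι).obj (Opposite.op X) ⟶ M}
    (h : ∀ d f, polyHom φ (swOf ι X d f) = polyHom ψ (swOf ι X d f)) : φ = ψ := by
  have key : (polyHom φ).toLinearMap = (polyHom ψ).toLinearMap :=
    DirectSum.linearMap_ext ℂ fun d => LinearMap.ext (h d)
  exact repPoly_hom_ext (LinearMap.congr_fun key)

lemma exists_component_of_swHom (hι : IsLarge ι D) {X Y : SumRepSym} (hY : DegreeLE D Y)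
    (φ : (SW ι).obj (Opposite.op Y) ⟶ (SW ι).obj (Opposite.op X)) (d : ℕ) :
    ∃ g : X.obj d ⟶ Y.obj d, ∀ (f : SWSpace ι (Y.obj d)) (x : X.obj d),
      swComponent ι X d (polyHom φ (swOf ι Y d f)) x = f (toIntertwining g x) := by
  obtain hd | hd := lt_or_ge D d
  · refine ⟨0, fun f x => ?_⟩
    rw [swSpace_eq_zero _ (hY d hd) f, map_zero, map_zero]
    rfl
  · exact exists_hom_of_swHom (hι.mono hd)
      (((swComponent ι X d).comp (polyHom φ)).comp (swOf ι Y d))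

lemma sw_hom_ext_component {X Y : SumRepSym}
    {φ ψ : (SW ι).obj (Opposite.op Y) ⟶ (SW ι).obj (Opposite.op X)}
    (h : ∀ d f, swComponent ι X d (polyHom φ (swOf ι Y d f)) =
      swComponent ι X d (polyHom ψ (swOf ι Y d f))) : φ = ψ :=
  sw_hom_ext fun d f => sw_ext fun d' => by
    obtain rfl | hd := eq_or_ne d' d
    · exact h d' f
    · have key (χ : (SW ι).obj (Opposite.op Y) ⟶ (SW ι).obj (Opposite.op X)) :=
        LieModuleHom.congr_fun
          (swHom_eq_zero hd (((swComponent ι X d').comp (polyHom χ)).comp (swOf ι Y d))) f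
      exact (key φ).trans (key ψ).symm

theorem sw_map_injective (hι : IsLarge ι D) {X Y : SumRepSym} (hY : DegreeLE D Y) {g h : X ⟶ Y}
    (hgh : (SW ι).map g.op = (SW ι).map h.op) : g = h :=
  ObjectProperty.hom_ext _ <| funext fun d => by
    obtain hd | hd := lt_or_ge D d
    · exact (hY d hd).eq_of_tgt _ _
    · obtain ⟨w, hw⟩ := (hι.mono hd).exists_injective
      refine repSym_hom_ext fun x => swSpace_separates hw fun f => ?_
      rw [← swComponent_map_swOf, hgh, swComponent_map_swOf]

theorem exists_sw_map_eq (hι : IsLarge ι D) {X Y : SumRepSym} (hY : DegreeLE D Y)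
    (φ : (SW ι).obj (Opposite.op Y) ⟶ (SW ι).obj (Opposite.op X)) :
    ∃ g : X ⟶ Y, (SW ι).map g.op = φ := by
  choose g hg using exists_component_of_swHom hι hY φ
  refine ⟨FinitelySupported.homMk g, sw_hom_ext_component fun d f => swSpace_ext fun x => ?_⟩
  rw [swComponent_map_swOf, hg]
  rfl

lemma faithful_swLE (hι : IsLarge ι D) : (swLE D ι).Faithful where
  map_injective {Y _ _ _} h := Quiver.Hom.unop_inj <| ObjectProperty.hom_ext _ <|
    sw_map_injective hι Y.unop.property h

lemma full_swLE (hι : IsLarge ι D) : (swLE D ι).Full where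
  map_surjective {Y _} φ := by
    obtain ⟨g, hg⟩ := exists_sw_map_eq hι Y.unop.property φ
    exact ⟨((DegreeLE D).homMk g).op, hg⟩

instance : (SW ι).Additive where
  map_add {X _} f g := repPoly_hom_ext fun m => sw_ext fun d => swSpace_ext fun x =>
    map_add (swComponent ι X.unop d m) (toIntertwining (f.unop.hom d) x)
      (toIntertwining (g.unop.hom d) x)

end DegreeLE

/-! ### Degrees of polynomial representations -/

section Degrees

variable {ι κ : Type} {d d' : ℕ}

instance (L : Type) [LieRing L] [LieAlgebra ℂ L] : IsIdempotentComplete (LieRep L) where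
  idempotents_split M e he := by
    let f : M.carrier →ₗ⁅ℂ,L⁆ M.carrier := e
    let r : M.carrier →ₗ⁅ℂ,L⁆ f.range :=
      { f.toLinearMap.rangeRestrict with
        map_lie' := fun {A m} => Subtype.ext (LieModuleHom.map_lie f A m) }
    refine ⟨⟨f.range⟩, f.range.incl, r, LieModuleHom.ext fun m => Subtype.ext ?_, rfl⟩
    obtain ⟨m', hm'⟩ := m.2
    calc f m = f (f m') := by rw [hm']
      _ = f m' := LieModuleHom.congr_fun he m'
      _ = m := hm'

instance : (IsPolynomial ι).IsStableUnderRetracts where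
  of_retract h hN := by
    obtain ⟨J, hJ, d, i, p, hip⟩ := hN
    let s : _ →ₗ⁅ℂ,gl ι⁆ _ := h.i
    let r : _ →ₗ⁅ℂ,gl ι⁆ _ := h.r
    exact ⟨J, hJ, d, i.comp s, r.comp p, fun m =>
      (congrArg r (hip (s m))).trans (LieModuleHom.congr_fun h.retract m)⟩

/-- The tensor power `(ℂ^N)^{⊗ d}` as an object of `Rep(𝔤𝔩_N)_poly`. -/
def tensorPoly (ι : Type) (d : ℕ) : RepPoly ι :=
  ⟨tensorRep ι d, isPolynomial_of_sum (J := Unit) _ (fun _ => d) (fun _ => LieModuleHom.id)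
    (fun _ => LieModuleHom.id) fun _ => Fintype.sum_unique _⟩

lemma exists_sum_comp_eq_id (M : RepPoly ι) :
    ∃ (J : Type) (_ : Fintype J) (d : J → ℕ) (i : ∀ j, M ⟶ tensorPoly ι (d j))
      (p : ∀ j, tensorPoly ι (d j) ⟶ M), ∑ j, i j ≫ p j = 𝟙 M := by
  obtain ⟨J, _, d, i, p, h⟩ := M.property.exists_sum
  refine ⟨J, inferInstance, d, fun j => ObjectProperty.homMk (i j),
    fun j => ObjectProperty.homMk (p j), repPoly_hom_ext fun m => ?_⟩
  exact (LieModuleHom.congr_fun (map_sum (IsPolynomial ι).ι.mapAddHom _ Finset.univ) m).trans <|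
    (lieModuleHom_sum_apply Finset.univ (fun j => (p j).comp (i j)) m).trans (h m)

lemma tensorPoly_hom_eq_zero (hd : d' ≠ d) (f : tensorPoly ι d ⟶ tensorPoly ι d') : f = 0 :=
  ObjectProperty.hom_ext _ (tensorHom_eq_zero hd (polyHom f))

lemma tensorPoly_hom_res_eq_zero (e : κ ↪ ι) (hd : d' ≠ d)
    (f : tensorPoly κ d ⟶ (resPoly e).obj (tensorPoly ι d')) : f = 0 := by
  let q : invariants e (tensorRep ι d').carrier →ₗ⁅ℂ,gl κ⁆ TPow κ d' :=
    { toFun := fun t => tproj e d' t.1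
      map_add' := fun t t' => map_add (tproj e d') t.1 t'.1
      map_smul' := fun c t => map_smul (tproj e d') c t.1
      map_lie' := fun {A t} => tproj_lie e A t.1 }
  have hq : q.comp (polyHom f) = 0 := tensorHom_eq_zero hd _
  refine repPoly_hom_ext fun t => Subtype.ext ?_
  exact ((tincl_tproj e _ (polyHom f t).2).symm.trans
    (congrArg (tincl e d') (LieModuleHom.congr_fun hq t))).trans (map_zero _)

/-- The polynomial representation `M` has degree `d` if there is a nonzero homomorphism from
`(ℂ^N)^{⊗ d}` to `M`. A representation can have several degrees. -/
def HasDegree (M : RepPoly ι) (d : ℕ) : Prop := ∃ f : tensorPoly ι d ⟶ M, f ≠ 0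

lemma HasDegree.of_mono {M N : RepPoly ι} (f : M ⟶ N) [Mono f] (h : HasDegree M d) :
    HasDegree N d := by
  obtain ⟨g, hg⟩ := h
  exact ⟨g ≫ f, fun h0 => hg (zero_of_comp_mono f h0)⟩

lemma HasDegree.of_res {e : κ ↪ ι} {M : RepPoly ι} (h : HasDegree ((resPoly e).obj M) d) :
    HasDegree M d := by
  obtain ⟨f, hf⟩ := h
  obtain ⟨J, _, d', i, p, hip⟩ := exists_sum_comp_eq_id M
  have hsum : ∑ j, (f ≫ (resPoly e).map (i j)) ≫ (resPoly e).map (p j) = f := by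
    simp only [Category.assoc, ← Functor.map_comp]
    rw [← Preadditive.comp_sum, ← Functor.map_sum, hip, CategoryTheory.Functor.map_id,
      Category.comp_id]
  rw [← hsum] at hf
  obtain ⟨j, -, hj⟩ := Finset.exists_ne_zero_of_sum_ne_zero hf
  obtain rfl : d' j = d := by
    by_contra hd
    exact hj (by rw [tensorPoly_hom_res_eq_zero e hd (f ≫ _), zero_comp])
  exact ⟨p j, fun hp => hj (by rw [hp, Functor.map_zero, comp_zero])⟩

lemma exists_orthogonalIdempotents_degree (M : RepPoly ι) :
    ∃ e : ℕ → End M, OrthogonalIdempotents e ∧ ∀ d (f : tensorPoly ι d ⟶ M), f ≫ e d = f := by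
  classical
  obtain ⟨J, _, deg, i, p, hip⟩ := exists_sum_comp_eq_id M
  let e : ℕ → (M ⟶ M) := fun d => ∑ j with deg j = d, i j ≫ p j
  have hne {k l : ℕ} (hkl : k ≠ l) (f : tensorPoly ι k ⟶ M) : f ≫ e l = 0 := by
    rw [Preadditive.comp_sum]
    refine Finset.sum_eq_zero fun j hj => ?_
    rw [← Category.assoc, tensorPoly_hom_eq_zero _ (f ≫ i j), zero_comp]
    rw [(Finset.mem_filter.1 hj).2]
    exact hkl.symm
  have heq (k : ℕ) (f : tensorPoly ι k ⟶ M) : f ≫ e k = f := by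
    conv_rhs => rw [← Category.comp_id f, ← hip]
    rw [Preadditive.comp_sum, Preadditive.comp_sum]
    refine Finset.sum_filter_of_ne fun j _ hj => ?_
    by_contra hd
    exact hj (by rw [← Category.assoc, tensorPoly_hom_eq_zero hd (f ≫ i j), zero_comp])
  refine ⟨e, ⟨fun k => ?_, fun k l hkl => ?_⟩, heq⟩
  · refine (Preadditive.sum_comp _ _ _).trans (Finset.sum_congr rfl fun j hj => ?_)
    obtain rfl := (Finset.mem_filter.1 hj).2
    rw [Category.assoc, heq]
  · refine (Preadditive.sum_comp _ _ _).trans (Finset.sum_eq_zero fun j hj => ?_)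
    obtain rfl := (Finset.mem_filter.1 hj).2
    rw [Category.assoc, hne hkl.symm, comp_zero]

lemma card_degrees_le_objectLength (M : RepPoly ι) {S : Finset ℕ} (hS : ∀ d ∈ S, HasDegree M d) :
    (S.card : ℕ∞) ≤ objectLength M := by
  obtain ⟨e, he, hf⟩ := exists_orthogonalIdempotents_degree M
  have h0 (d : S) : e d ≠ 0 := fun h => by
    obtain ⟨f, hf0⟩ := hS d d.2
    exact hf0 (by rw [← hf d f, h, comp_zero])
  simpa using card_le_objectLength (he.embedding (.subtype _)) h0

theorem exists_degree_bound {M : InvLim RepPolyFin Res} (hM : BoundedLength RepPolyFin Res M) :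
    ∃ D, ∀ n d, HasDegree (M.obj n) d → d ≤ D := by
  obtain ⟨l, hl⟩ := hM
  have hstep (n d : ℕ) (h : HasDegree (M.obj n) d) : HasDegree (M.obj (n + 1)) d :=
    (h.of_mono (M.iso n).inv).of_res
  have hmono {m n : ℕ} (hmn : m ≤ n) (d : ℕ) (h : HasDegree (M.obj m) d) :
      HasDegree (M.obj n) d :=
    Nat.le_induction h (fun n _ => hstep n d) n hmn
  suffices hfin : {d | ∃ n, HasDegree (M.obj n) d}.Finite by
    obtain ⟨D, hD⟩ := hfin.bddAbove
    exact ⟨D, fun n d h => hD ⟨n, h⟩⟩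
  by_contra hinf
  obtain ⟨S, hS, hcard⟩ := Set.Infinite.exists_subset_card_eq hinf (l + 1)
  choose! N hN using hS
  have h := (card_degrees_le_objectLength (M.obj (S.sup N)) fun d hd =>
    hmono (Finset.le_sup hd) d (hN hd)).trans (hl _)
  rw [hcard, Nat.cast_le] at h
  omega

end Degrees

/-! ### Generators and bounded lengths -/

section Generator

variable {ι : Type} {d D : ℕ}

instance [Finite ι] : Module.Finite ℂ (tensorRep ι d).carrier := Module.Finite.of_basis (tbasis ι d)

instance [Finite ι] (M : RepPoly ι) : Module.Finite ℂ M.obj.carrier := by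
  obtain ⟨J, _, d, i, p, hip⟩ := M.property
  have := Fintype.ofFinite J
  exact Module.Finite.of_surjective (p : _ →ₗ[ℂ] M.obj.carrier) fun m => ⟨i m, hip m⟩

instance [Finite ι] (M N : RepPoly ι) : FiniteDimensional ℂ (M ⟶ N) :=
  let φ : (M ⟶ N) →ₗ[ℂ] M.obj.carrier →ₗ[ℂ] N.obj.carrier :=
    { toFun := fun f => (polyHom f).toLinearMap
      map_add' := fun _ _ => rfl
      map_smul' := fun _ _ => rfl }
  FiniteDimensional.of_injective φ fun _ _ h => repPoly_hom_ext (LinearMap.congr_fun h)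

/-- The regular representation of `S_d`. -/
def regRep (d : ℕ) : RepSym d := FDRep.of (Representation.leftRegular ℂ (Equiv.Perm (Fin d)))

open scoped ZeroObject in
/-- The sum of the regular representations of `S_d` over `d ≤ D`. -/
def regSum (D : ℕ) : SumRepSym :=
  ⟨fun d => if d ≤ D then regRep d else 0, (Set.finite_Iic D).subset fun d hd => by
    by_contra h
    exact hd ((isZero_zero (RepSym d)).of_iso (eqToIso (if_neg h)))⟩

lemma degreeLE_regSum (D : ℕ) : DegreeLE D (regSum D) := fun d hd =>
  (isZero_zero (RepSym d)).of_iso (eqToIso (if_neg hd.not_ge))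

lemma exists_regSum_apply_ρ_inv (hd : d ≤ D) :
    ∃ (x : (regSum D).obj d) (l : (regSum D).obj d →ₗ[ℂ] ℂ),
      ∀ σ, l (((regSum D).obj d).ρ σ⁻¹ x) = if σ = 1 then 1 else 0 := by
  rw [show (regSum D).obj d = regRep d from if_pos hd]
  refine ⟨MonoidAlgebra.single 1 1, (Finsupp.lapply 1).comp
    (MonoidAlgebra.coeffLinearEquiv ℂ).toLinearMap, fun σ => ?_⟩
  change (Representation.leftRegular ℂ _ σ⁻¹ (MonoidAlgebra.single 1 1)).coeff 1 = _
  rw [Representation.ofMulAction_single]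
  simp [Finsupp.single_apply]

/-- The homomorphism `(ℂ^N)^{⊗ d} → SW_N(X)` attached to a linear form on `X_d`. -/
def tensorToSW (ι : Type) (X : SumRepSym) {d : ℕ} (l : X.obj d →ₗ[ℂ] ℂ) :
    tensorPoly ι d ⟶ (SW ι).obj (Opposite.op X) :=
  ObjectProperty.homMk ((swOf ι X d).comp (averageForm (X.obj d) l))

/-- The evaluation `SW_N(X) → (ℂ^N)^{⊗ d}` at a vector of `X_d`. -/
def swToTensor (ι : Type) (X : SumRepSym) {d : ℕ} (x : X.obj d) :
    (SW ι).obj (Opposite.op X) ⟶ tensorPoly ι d :=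
  ObjectProperty.homMk ((evalAt (X.obj d) x).comp (swComponent ι X d))

lemma averageForm_apply_eq_inv_card_smul {X : RepSym d} {l : X →ₗ[ℂ] ℂ} {x : X}
    (h : ∀ σ, l (X.ρ σ⁻¹ x) = if σ = 1 then 1 else 0) (t : TPow ι d) :
    averageForm X l t x = (Fintype.card (Equiv.Perm (Fin d)) : ℂ)⁻¹ • t := by
  rw [averageForm_apply, Finset.sum_eq_single 1 (fun σ _ hσ => by rw [h, if_neg hσ, zero_smul])
    fun h1 => absurd (Finset.mem_univ _) h1, h, if_pos rfl, one_smul, map_one,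
    Module.End.one_apply]

lemma exists_tensorToSW_comp_swToTensor (ι : Type) (hd : d ≤ D) :
    ∃ (i : tensorPoly ι d ⟶ (SW ι).obj (Opposite.op (regSum D)))
      (p : (SW ι).obj (Opposite.op (regSum D)) ⟶ tensorPoly ι d), i ≫ p = 𝟙 _ := by
  obtain ⟨x, l, hl⟩ := exists_regSum_apply_ρ_inv hd
  refine ⟨tensorToSW ι _ l, (Fintype.card (Equiv.Perm (Fin d)) : ℂ) • swToTensor ι _ x,
    repPoly_hom_ext fun t => ?_⟩
  change (_ : ℂ) • swComponent ι _ d (swOf ι _ d (averageForm _ l t)) x = t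
  rw [swComponent_swOf]
  exact (congrArg _ (averageForm_apply_eq_inv_card_smul hl t)).trans
    (smul_inv_smul₀ (Nat.cast_ne_zero.2 Fintype.card_ne_zero) t)

lemma exists_forall_hasDegree_le (M : RepPoly ι) : ∃ D, ∀ d, HasDegree M d → d ≤ D := by
  obtain ⟨J, _, deg, i, p, hip⟩ := exists_sum_comp_eq_id M
  refine ⟨Finset.univ.sup deg, fun d ⟨f, hf⟩ => ?_⟩
  rw [← Category.comp_id f, ← hip, Preadditive.comp_sum] at hf
  obtain ⟨j, -, hj⟩ := Finset.exists_ne_zero_of_sum_ne_zero hf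
  obtain rfl : deg j = d := by
    by_contra hd
    exact hj (by rw [← Category.assoc, tensorPoly_hom_eq_zero hd (f ≫ i j), zero_comp])
  exact Finset.le_sup (Finset.mem_univ j)

lemma isSummandOfPower_sw_regSum {M : RepPoly ι} (hM : ∀ d, HasDegree M d → d ≤ D) :
    IsSummandOfPower M ((SW ι).obj (Opposite.op (regSum D))) := by
  obtain ⟨J, _, deg, i, p, hip⟩ := exists_sum_comp_eq_id M
  have key (j : J) : ∃ (s : M ⟶ (SW ι).obj (Opposite.op (regSum D)))
      (r : (SW ι).obj (Opposite.op (regSum D)) ⟶ M), s ≫ r = i j ≫ p j := by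
    by_cases hp : p j = 0
    · exact ⟨0, 0, by rw [hp, comp_zero, comp_zero]⟩
    · obtain ⟨s, r, hsr⟩ := exists_tensorToSW_comp_swToTensor ι (hM _ ⟨p j, hp⟩)
      exact ⟨i j ≫ s, r ≫ p j, by rw [Category.assoc, reassoc_of% hsr]⟩
  choose s r hsr using key
  exact ⟨J, inferInstance, s, r, by simp only [hsr, hip]⟩

lemma HasDegree.le_of_sw {X : SumRepSym} (hX : DegreeLE D X)
    (h : HasDegree ((SW ι).obj (Opposite.op X)) d) : d ≤ D := by
  obtain ⟨f, hf⟩ := h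
  contrapose! hf
  refine repPoly_hom_ext fun t => sw_ext fun d' => swSpace_ext fun x => ?_
  obtain rfl | hd := eq_or_ne d' d
  · exact congrArg (fun g : SWSpace ι (X.obj d') => g x)
      ((swSpace_eq_zero _ (hX d' hf) _).trans (swSpace_eq_zero _ (hX d' hf) _).symm)
  · exact congrArg (fun g => polyHom g t) (tensorPoly_hom_eq_zero hd (f ≫ swToTensor ι X x))

lemma sw_map_smul {X Y : SumRepSym} (c : ℂ) (f : X ⟶ Y) :
    (SW ι).map (c • f).op = c • (SW ι).map f.op :=
  repPoly_hom_ext fun m => sw_ext fun d => swSpace_ext fun x =>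
    map_smul (swComponent ι Y d m) c (toIntertwining (f.hom d) x)

lemma finrank_sw_hom_le (hι : IsLarge ι D) (X : SumRepSym) {Y : SumRepSym} (hY : DegreeLE D Y) :
    Module.finrank ℂ ((SW ι).obj (Opposite.op Y) ⟶ (SW ι).obj (Opposite.op X)) ≤
      Module.finrank ℂ (X ⟶ Y) :=
  LinearMap.finrank_le_finrank_of_surjective
    (f := { toFun := fun g : X ⟶ Y => (SW ι).map g.op
            map_add' := fun g h => (SW ι).map_add (f := g.op) (g := h.op)
            map_smul' := sw_map_smul })
    (exists_sw_map_eq hι hY)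

lemma objectLength_sw_le [Finite ι] {X : SumRepSym} (hX : DegreeLE D X) :
    objectLength ((SW ι).obj (Opposite.op X)) ≤
      Module.finrank ℂ ((SW ι).obj (Opposite.op (regSum D)) ⟶ (SW ι).obj (Opposite.op X)) :=
  objectLength_le_finrank ℂ fun N =>
    isSummandOfPower_sw_regSum fun _ h => (h.of_mono N.arrow).le_of_sw hX

theorem boundedLength_swInvLim (X : SumRepSymᵒᵖ) :
    BoundedLength RepPolyFin Res (SWInvLim.obj X) := by
  obtain ⟨D, hD⟩ := exists_degreeLE X.unop
  let f (n : ℕ) : ℕ := Module.finrank ℂ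
    ((SW (Fin n)).obj (Opposite.op (regSum D)) ⟶ (SW (Fin n)).obj X)
  refine ⟨max ((Finset.range (3 * D)).sup f) (Module.finrank ℂ (X.unop ⟶ regSum D)), fun n =>
    (objectLength_sw_le hD).trans (Nat.cast_le.2 ?_)⟩
  obtain hn | hn := lt_or_ge n (3 * D)
  · exact (Finset.le_sup (f := f) (Finset.mem_range.2 hn)).trans (le_max_left _ _)
  · exact (finrank_sw_hom_le (isLarge_fin hn) X.unop (degreeLE_regSum D)).trans (le_max_right _ _)

end Generator

/-! ### Anti-equivalences -/

section AntiEquivalence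

instance (D : ℕ) : HasFiniteBiproducts (DegreeLE D).FullSubcategoryᵒᵖ :=
  have : HasFiniteBiproducts (DegreeLE D).FullSubcategory := .of_hasFiniteProducts
  have : HasFiniteProducts (DegreeLE D).FullSubcategoryᵒᵖ := hasFiniteProducts_opposite
  .of_hasFiniteProducts

lemma sw_essImage {ι : Type} {D : ℕ} (hι : IsLarge ι D) {M : RepPoly ι}
    (hM : ∀ d, HasDegree M d → d ≤ D) : (swLE D ι).essImage M := by
  have := faithful_swLE hι
  have := full_swLE hι
  exact IsSummandOfPower.essImage (G := swLE D ι) (R := Opposite.op ⟨regSum D, degreeLE_regSum D⟩)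
    (isSummandOfPower_sw_regSum hM)

theorem isAntiEquivalence_swInfty : IsAntiEquivalence SWInfty where
  isEquivalence :=
    { faithful := ⟨fun {Y _ _ _} h => by
        obtain ⟨D, hD⟩ := exists_degreeLE Y.unop
        exact Quiver.Hom.unop_inj (sw_map_injective (isLarge_nat D) hD h)⟩
      full := ⟨fun {Y _} φ => by
        obtain ⟨D, hD⟩ := exists_degreeLE Y.unop
        obtain ⟨g, hg⟩ := exists_sw_map_eq (isLarge_nat D) hD φ
        exact ⟨g.op, hg⟩⟩
      essSurj := ⟨fun M => by
        obtain ⟨D, hD⟩ := exists_forall_hasDegree_le M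
        obtain ⟨X, ⟨φ⟩⟩ := sw_essImage (isLarge_nat D) hD
        exact ⟨Opposite.op X.unop.obj, ⟨φ⟩⟩⟩ }
  map_add f g := SWInfty.map_add (f := f.op) (g := g.op)
  map_smul := sw_map_smul

/-- The Schur–Weyl functor to the inverse limit on families of representations in degrees at most
`D`. -/
abbrev swInvLimLE (D : ℕ) : (DegreeLE D).FullSubcategoryᵒᵖ ⥤ InvLim RepPolyFin Res :=
  (DegreeLE D).ι.op ⋙ SWInvLim

lemma swInvLimLE_eq_lift (D : ℕ) : swInvLimLE D = InvLim.lift (fun n => swLE D (Fin n)) fun _ =>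
    Functor.isoWhiskerLeft _ (swResIso Fin.castSuccEmb) :=
  rfl

lemma full_swInvLimLE (D : ℕ) : (swInvLimLE D).Full := by
  rw [swInvLimLE_eq_lift]
  exact InvLim.lift_full _ _ (3 * D) (fun n hn => full_swLE (isLarge_fin hn))
    fun n hn => faithful_swLE (isLarge_fin hn)

lemma faithful_swInvLim : SWInvLim.Faithful where
  map_injective {Y _ g h} hgh := by
    obtain ⟨D, hD⟩ := exists_degreeLE Y.unop
    exact Quiver.Hom.unop_inj (sw_map_injective (isLarge_fin le_rfl) hD
      (congrArg (fun φ => φ.app (3 * D)) hgh))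

lemma exists_swInvLim_map_eq {D : ℕ} {X Y : SumRepSym} (hX : DegreeLE D X) (hY : DegreeLE D Y)
    (φ : SWInvLim.obj (Opposite.op Y) ⟶ SWInvLim.obj (Opposite.op X)) :
    ∃ g : X ⟶ Y, SWInvLim.map g.op = φ := by
  let X' : (DegreeLE D).FullSubcategory := ⟨X, hX⟩
  let Y' : (DegreeLE D).FullSubcategory := ⟨Y, hY⟩
  obtain ⟨g, hg⟩ := (full_swInvLimLE D).map_surjective (X := Opposite.op Y') (Y := Opposite.op X') φ
  exact ⟨g.unop.hom, hg⟩

lemma full_swInvLim : SWInvLim.Full where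
  map_surjective {Y X} φ := by
    obtain ⟨D, hY⟩ := exists_degreeLE Y.unop
    obtain ⟨D', hX⟩ := exists_degreeLE X.unop
    obtain ⟨g, hg⟩ := exists_swInvLim_map_eq (DegreeLE.mono (le_max_right D D') X.unop hX)
      (DegreeLE.mono (le_max_left D D') Y.unop hY) φ
    exact ⟨g.op, hg⟩

lemma swInvLim_essImage {M : InvLim RepPolyFin Res} (hM : BoundedLength RepPolyFin Res M) :
    SWInvLim.essImage M := by
  obtain ⟨D, hD⟩ := exists_degree_bound hM
  have h : (swInvLimLE D).essImage M := by
    rw [swInvLimLE_eq_lift]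
    exact InvLim.essImage_lift _ _ (3 * D) (fun n hn => full_swLE (isLarge_fin hn))
      (fun n hn => faithful_swLE (isLarge_fin hn)) fun n hn => sw_essImage (isLarge_fin hn) (hD n)
  obtain ⟨X, ⟨φ⟩⟩ := h
  exact ⟨Opposite.op X.unop.obj, ⟨φ⟩⟩

theorem isAntiEquivalence_swInvLim : IsAntiEquivalence
    ((BoundedLength RepPolyFin Res).lift SWInvLim boundedLength_swInvLim) where
  isEquivalence :=
    have := faithful_swInvLim
    have := full_swInvLim
    { essSurj := ⟨fun M => by
        obtain ⟨X, ⟨φ⟩⟩ := swInvLim_essImage M.property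
        exact ⟨X, ⟨ObjectProperty.isoMk _ φ⟩⟩⟩ }
  map_add f g := ObjectProperty.hom_ext _ <| InvLim.hom_ext fun n =>
    (SW (Fin n)).map_add (f := f.op) (g := g.op)
  map_smul c f := ObjectProperty.hom_ext _ <| InvLim.hom_ext fun _ => sw_map_smul c f

end AntiEquivalence

end SchurWeyl

end

theorem mainTheorem7 :
    SchurWeyl.IsSemisimpleCategory SchurWeyl.SumRepSym ∧
    SchurWeyl.IsSemisimpleCategory (SchurWeyl.RepPoly ℕ) ∧
    SchurWeyl.IsSemisimpleCategory SchurWeyl.RestrRepPoly ∧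
    SchurWeyl.IsAntiEquivalence SchurWeyl.SWInfty ∧
    ∃ h : ∀ X, SchurWeyl.BoundedLength SchurWeyl.RepPolyFin SchurWeyl.Res (SchurWeyl.SWInvLim.obj X),
      SchurWeyl.IsAntiEquivalence
        ((SchurWeyl.BoundedLength SchurWeyl.RepPolyFin SchurWeyl.Res).lift SchurWeyl.SWInvLim h) :=
  ⟨SchurWeyl.isSemisimpleCategory_sumRepSym,
    SchurWeyl.isSemisimpleCategory_sumRepSym.of_isAntiEquivalence
      SchurWeyl.isAntiEquivalence_swInfty,
    SchurWeyl.isSemisimpleCategory_sumRepSym.of_isAntiEquivalence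
      SchurWeyl.isAntiEquivalence_swInvLim,
    SchurWeyl.isAntiEquivalence_swInfty,
    SchurWeyl.boundedLength_swInvLim,
    SchurWeyl.isAntiEquivalence_swInvLim⟩
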